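/- Throughout, $\delta\in\mathbb Z$, $\mathbb N=\{1,2,3,\dots\}$, and $\Lambda$ is the set of all integer partitions (Young diagrams). The box in row $i$ and column $j$ has $\delta$-charge $\delta-1-2(j-i)$. A rim is a skew diagram whose boxes, joined when they share an edge, form a non-empty chain (path). For $\mu\subset\lambda$ the skew $\lambda/\mu$ is a minimal $\delta$-balanced skew if it is the disjoint union of two rims that are exchanged by a rotation by $\pi$ about a point of the line of $\delta$-charge $0$, such that this rotation fixes no row of the skew. The block $[\lambda]_\delta$ is the class of $\lambda$ under the equivalence relation on $\Lambda$ generated by the pairs $(\mu,\nu)$ with $\nu/\mu$ a minimal $\delta$-balanced skew, and the block graph $G_\delta(\lambda)$ is the directed graph with vertex set $[\lambda]_\delta$ and an edge $\mu\to\nu$ whenever $\nu/\mu$ is a minimal $\delta$-balanced skew. $G_{even}$ (resp. $G_{odd}$) is the directed graph whose vertices are the finite subsets of $\mathbb N$ of even (resp. odd) order, with an edge $a\to b$ if $a\setminus b=\{\alpha\}$ and $b\setminus a=\{\alpha+1\}$ for some $\alpha\in\mathbb N$, or if $a\setminus b=\emptyset$ and $b\setminus a=\{1,2\}$. The toggle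 map is $a\mapsto a\,\triangle\,\{1\}$. For $\lambda\in\Lambda$ put $e_\delta(\lambda)=\lambda-\tfrac{\delta}{2}(1,1,1,\dots)-(0,1,2,\dots)\in\mathbb R^{\mathbb N}$, and let $v$ be the sequence obtained from $e_\delta(\lambda)$ by deleting all pairs of terms $x,-x$ (at two distinct places). Let $o(v)$ be the sequence for which $|o(v)_i|$ is the position of $|v_i|$ among the magnitudes of the terms of $v$ in increasing order, and $o(v)_i$ has the sign of $v_i$, except that the sign of a term with $v_i=0$ is chosen so that the number of positive terms is even. Let $u_\delta(\lambda)\subset\mathbb N$ be the set of positive terms of $o(v)$, and let $o_\delta(\lambda)$ be $u_\delta(\lambda)$ if this set is of even order, and $u_\delta(\lambda)\,\triangle\,\{1\}$ otherwise. Let $\mathcal D$ be the group of transformations of $\mathbb R^{\mathbb N}$ generated, for $i<j$, by $(ij)$, which exchanges the $i$-th and $j$-th entries, and $(ij)_-$, which exchanges these entries and changes the sign of both. Alcoves are the connected components of $\mathbb R^{\mathbb N}$ (product topology) minus all hyperplanes $v_i=v_j$ and $v_i=-v_j$, $i<j$; the fundamental alcove is $C'=\{v: v_1>v_2>\cdots,\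 v_1+v_2<0\}$. The vertices of $G_{alc}$ are the dominant alcoves, i.e. the alcoves in the $\mathcal D$-orbit of $C'$ that consist of strictly descending sequences. There is an edge $A\to B$ if the closures of $A$ and $B$ have in common a point that lies on exactly one of the hyperplanes and the number of hyperplanes separating $B$ from $C'$ is one more than that for $A$. Theorem. (a) The toggle map is an isomorphism of directed graphs $G_{odd}\to G_{even}$, and there is an isomorphism $G_{even}\to G_{alc}$ that sends $o_2(\mu)$ to the alcove containing $e_2(\mu)$ for each $\mu\in[\emptyset]_2$. (b) For all $\delta\in\mathbb Z$ and $\lambda\in\Lambda$, the map $o_\delta$ restricts to a bijection from $[\lambda]_\delta$ onto the set of finite subsets of $\mathbb N$ of even order, and this bijection is an isomorphism of directed graphs $G_\delta(\lambda)\cong G_{even}$. If $u_\delta(\lambda)$ is of even order, this isomorphism is $\nu\mapsto u_\delta(\nu)$; if $u_\delta(\lambda)$ is of odd order, then $\nu\mapsto u_\delta(\nu)$ is an isomorphism $G_\delta(\lambda)\cong G_{odd}$, and $o_\delta$ is its composite with the toggle map. (c) For all $\delta\in\mathbb Z$ and $\lambda\in\Lambda$ there is an isomorphism $G_\delta(\lambda)\cong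 G_{alc}$ that sends $\nu$ to the alcove containing $e_2(\mu)$, where $\mu$ is the partition in $[\emptyset]_2$ with $o_2(\mu)=o_\delta(\nu)$. (d) Consequently $G_\delta(\lambda)\cong G_{\delta'}(\lambda')$ for all $\delta,\delta'\in\mathbb Z$ and $\lambda,\lambda'\in\Lambda$. -/

import Mathlib

namespace BrauerBlock

noncomputable section

/-! ### Young diagrams, rims and the block relation

Integer partitions are `YoungDiagram`s; the box in row `i` and column `j` (both counted from `0`)
is the pair `(i, j)`. The plane is `ℝ × ℝ` with coordinates (row, column), rows growing downwards,
and a box is located by its centre, taken at the point `(i, j)`. -/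

/-- A finite set of boxes is a skew if it is the difference of two nested Young diagrams. -/
def IsSkew (R : Finset (ℕ × ℕ)) : Prop :=
  ∃ μ ν : YoungDiagram, μ ≤ ν ∧ R = ν.cells \ μ.cells

/-- The dual graph of a set of boxes: two boxes are joined when they have a common edge. -/
def dualGraph (R : Finset (ℕ × ℕ)) : SimpleGraph R :=
  SimpleGraph.fromRel fun a b =>
    (a.1.1 = b.1.1 ∧ a.1.2 + 1 = b.1.2) ∨ (a.1.2 = b.1.2 ∧ a.1.1 + 1 = b.1.1)

/-- A rim is a skew whose dual graph is a (nonempty) chain. -/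
def IsRim (R : Finset (ℕ × ℕ)) : Prop :=
  IsSkew R ∧ ∃ n : ℕ, Nonempty (dualGraph R ≃g SimpleGraph.pathGraph (n + 1))

/-- The centre of a box, as a point of the plane. -/
def centre (b : ℕ × ℕ) : ℝ × ℝ := ((b.1 : ℝ), (b.2 : ℝ))

/-- The `δ`-charge `δ - 1 - 2 (column - row)`, extended from box centres to all points of the
plane. -/
def charge (δ : ℤ) (x : ℝ × ℝ) : ℝ := (δ : ℝ) - 1 - 2 * (x.2 - x.1)

/-- The rotation of the plane by `π` about the point `c`. -/
def piRotation (c x : ℝ × ℝ) : ℝ × ℝ := (2 * c.1 - x.1, 2 * c.2 - x.2)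

/-- The skew `ν / μ` is a minimal `δ`-balanced skew: it is a pair of rims that are exchanged by
a `π`-rotation about a point `c` of the `δ`-charge-`0` diagonal, and no row of the skew is fixed
by this rotation (that is, `c` is not on the mid-line of any row that meets the skew). -/
def IsMinBalancedSkew (δ : ℤ) (μ ν : YoungDiagram) : Prop :=
  μ ≤ ν ∧ ∃ R R' : Finset (ℕ × ℕ),
    IsRim R ∧ IsRim R' ∧ Disjoint R R' ∧ ν.cells \ μ.cells = R ∪ R' ∧
    ∃ c : ℝ × ℝ, charge δ c = 0 ∧
      piRotation c '' (centre '' (R : Set (ℕ × ℕ))) = centre '' (R' : Set (ℕ × ℕ)) ∧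
      ∀ b ∈ ν.cells \ μ.cells, (piRotation c (centre b)).1 ≠ (centre b).1

/-- The strict order `<^δ`: the transitive closure of "`ν / μ` is a minimal `δ`-balanced skew". -/
def ltDelta (δ : ℤ) : YoungDiagram → YoungDiagram → Prop :=
  Relation.TransGen (IsMinBalancedSkew δ)

/-- The block `[λ]_δ`: the class of `λ` for the reflexive-symmetric-transitive closure of
`<^δ`. -/
def block (δ : ℤ) (lam : YoungDiagram) : Set YoungDiagram :=
  {μ | Relation.EqvGen (ltDelta δ) lam μ}

/-- The block graph `G_δ(λ)`: an edge goes from `μ` to `ν` when `ν / μ` is a minimal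
`δ`-balanced skew. -/
def blockGraph (δ : ℤ) (lam : YoungDiagram) : Digraph (block δ lam) where
  Adj μ ν := IsMinBalancedSkew δ μ ν

/-! ### The graphs on subsets of `{1, 2, 3, …}` -/

/-- Subsets of `{1, 2, 3, …}` of even (finite) order. -/
def evenSubsets : Set (Set ℕ+) := {a | a.Finite ∧ Even a.ncard}

/-- Subsets of `{1, 2, 3, …}` of odd (finite) order. -/
def oddSubsets : Set (Set ℕ+) := {a | a.Finite ∧ Odd a.ncard}

/-- Edge labels: a number `α`, or the symbol `12`. -/
inductive EdgeLabel
  | num (α : ℕ+)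
  | oneTwo

/-- `a → b` with the given label. -/
def LabelledEdge : EdgeLabel → Set ℕ+ → Set ℕ+ → Prop
  | .num α, a, b => a \ b = {α} ∧ b \ a = {α + 1}
  | .oneTwo, a, b => a \ b = ∅ ∧ b \ a = {1, 2}

/-- The graph `G_even`. -/
def graphEven : Digraph evenSubsets where
  Adj a b := ∃ l, LabelledEdge l a b

/-- The graph `G_odd`. -/
def graphOdd : Digraph oddSubsets where
  Adj a b := ∃ l, LabelledEdge l a b

/-- Toggling the presence of `1`. -/
def toggle (a : Set ℕ+) : Set ℕ+ := symmDiff a {1}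

/-! ### The map `o_δ`

Sequences are indexed from `0`, so that the `i`-th entry here is the `(i+1)`-st entry in
one-based numbering. -/

/-- `e_δ(λ) = λ + ρ_δ` with `ρ_δ = -(δ/2)(1,1,…) - (0,1,2,…)`. -/
def eMap (δ : ℤ) (lam : YoungDiagram) : ℕ → ℝ :=
  fun i => (lam.rowLen i : ℝ) - (δ : ℝ) / 2 - (i : ℝ)

/-- `Reg`: the subsequence left after the removal of all doubletons, that is of all pairs of terms
(at two distinct places) of the form `x, -x`. -/
def regularize (v : ℕ → ℝ) : ℕ → ℝ :=
  fun n => v (Nat.nth (fun i => ∀ j, j ≠ i → v j ≠ -v i) n)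

/-- The map `o` on regular, strongly descending sequences: `|o(v)_i|` is the position (from `1`) of
`v_i` in the magnitude ordering of the terms of `v`; the sign of `o(v)_i` is that of `v_i`, except
that for `v_i = 0` it is chosen so as to make the number of positive terms even. -/
def signedRank (v : ℕ → ℝ) : ℕ → ℤ := fun i =>
  if 0 < v i ∨ (v i = 0 ∧ Odd {j | 0 < v j}.ncard) then
    ({j | |v j| ≤ |v i|}.ncard : ℤ)
  else
    -({j | |v j| ≤ |v i|}.ncard : ℤ)

/-- The set of positive terms of an integer sequence. -/
def positiveTerms (w : ℕ → ℤ) : Set ℕ+ := {n | ∃ i, w i = ((n : ℕ) : ℤ)}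

/-- The positive terms of `o(Reg(e_δ(λ)))`, before any toggling. -/
def untoggled (δ : ℤ) (lam : YoungDiagram) : Set ℕ+ :=
  positiveTerms (signedRank (regularize (eMap δ lam)))

open Classical in
/-- The map `o_δ`: the positive terms of `o(Reg(e_δ(λ)))`, with the presence of `1` toggled if this
set is of odd order. -/
def oMap (δ : ℤ) (lam : YoungDiagram) : Set ℕ+ :=
  if Odd (untoggled δ lam).ncard then toggle (untoggled δ lam) else untoggled δ lam

/-! ### The dominant alcove graph

`ℕ → ℝ` carries the product topology. -/

/-- The reflection `(ij)`, exchanging the entries `v i` and `v j`. -/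
def reflPlus (i j : ℕ) : Equiv.Perm (ℕ → ℝ) :=
  Function.Involutive.toPerm (fun v k => v (Equiv.swap i j k)) (by
    intro v; funext k; simp)

/-- The reflection `(ij)_-`, exchanging the entries `v i` and `v j` and changing the sign of
both. -/
def reflMinus (i j : ℕ) : Equiv.Perm (ℕ → ℝ) :=
  Function.Involutive.toPerm
    (fun v k => if k = i ∨ k = j then -v (Equiv.swap i j k) else v k) (by
    intro v; funext k
    by_cases hi : k = i
    · subst hi; simp
    · by_cases hj : k = j
      · subst hj; simp
      · simp [hi, hj])

/-- The reflection group `𝒟` generated by all `(ij)` and `(ij)_-` with `i < j`. -/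
def groupD : Subgroup (Equiv.Perm (ℕ → ℝ)) :=
  Subgroup.closure {s | ∃ i j, i < j ∧ (s = reflPlus i j ∨ s = reflMinus i j)}

/-- The reflection hyperplanes of the reflections `(ij)` and `(ij)_-`, `i < j`. -/
def hyperplanes : Set (Set (ℕ → ℝ)) :=
  {H | ∃ i j, i < j ∧ (H = {v | v i = v j} ∨ H = {v | v i = -v j})}

/-- An alcove is a connected component of the space with all the hyperplanes removed. -/
def IsAlcove (A : Set (ℕ → ℝ)) : Prop :=
  ∃ x ∈ (⋃₀ hyperplanes)ᶜ, A = connectedComponentIn (⋃₀ hyperplanes)ᶜ x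

/-- The fundamental chamber for the parabolic subgroup generated by the `(ij)`: the strictly
descending sequences. -/
def fundamentalChamber : Set (ℕ → ℝ) := {v | StrictAnti v}

/-- The fundamental alcove: the part of the fundamental chamber bounded by the hyperplane of
`(12)_-`, on the side `v₁ + v₂ < 0`, which contains `(-1, -2, -3, …)`. -/
def fundamentalAlcove : Set (ℕ → ℝ) := {v | StrictAnti v ∧ v 0 + v 1 < 0}

/-- The dominant alcoves of the reflection group `𝒟`: the alcoves in the `𝒟`-orbit of the
fundamental alcove that lie in the fundamental chamber. -/
def dominantAlcoves : Set (Set (ℕ → ℝ)) :=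
  {A | IsAlcove A ∧ (∃ w ∈ groupD, A = w '' fundamentalAlcove) ∧ A ⊆ fundamentalChamber}

/-- The hyperplane `H` separates the alcoves `A` and `B`. -/
def Separates (H A B : Set (ℕ → ℝ)) : Prop :=
  ∀ a ∈ A, ∀ b ∈ B, (segment ℝ a b ∩ H).Nonempty

/-- The length of an alcove: the number of hyperplanes separating it from the fundamental alcove. -/
def alcoveLength (A : Set (ℕ → ℝ)) : ℕ :=
  {H | H ∈ hyperplanes ∧ Separates H fundamentalAlcove A}.ncard

/-- The closures of `A` and `B` meet in a wall: their intersection contains a point of some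
hyperplane `H` that is on no other hyperplane. -/
def ShareWall (A B : Set (ℕ → ℝ)) : Prop :=
  ∃ H ∈ hyperplanes, (closure A ∩ closure B ∩ (H \ ⋃₀ (hyperplanes \ {H}))).Nonempty

/-- The dominant alcove graph `G_alc`: adjacent alcoves are joined, and edges are directed away
from the fundamental alcove. -/
def graphAlc : Digraph dominantAlcoves where
  Adj A B := ShareWall A B ∧ alcoveLength B = alcoveLength A + 1

/-- Isomorphisms of directed graphs. -/
abbrev DigraphIso {V W : Type*} (G : Digraph V) (H : Digraph W) := G.Adj ≃r H.Adj

end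

end BrauerBlock

/-! A partition `μ` is encoded by its beads `μ_i - i`. Adding a rim moves one bead upwards, so that
a minimal `δ`-balanced skew moves a bead `p` to `q` and the reflected bead `δ - q` to `δ - p`. On
the doubled entries `2 (μ_i - i) - δ` of `e_δ(μ)` the reflection becomes `z ↦ -z`, and the move
changes the signs of two entries. The symmetry of the two rims means that no nonzero magnitude
between those of the two entries occurs with one sign only, and the condition on the rows deals with
the entry `0`. Recording the ranks of the positive magnitudes turns the move into an edge of the
subset graph. The block consists of the partitions with the same magnitudes and the same parity of
the number of positive entries.

On the side of the alcoves, a finite set `a ⊆ ℕ` of even order gives the descending arrangement `s`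
of the integers `n`, `n ∈ a`, and `-n`, `n ∉ a`. Its alcove is determined by the pairs `i < j` with
`s i + s j > 0`, and these pairs are also the hyperplanes separating it from the fundamental alcove.
Two alcoves share a wall when these sets of pairs differ in one element `(i, j)`, and then one
sequence arises from the other by the reflection `(ij)_-`, which is again an edge of the subset
graph. For `δ = 2` and the empty diagram, `s` is `e_2(μ)` itself. -/

namespace BrauerBlock

/-- The beads of a Young diagram: the strictly decreasing sequence `rowLen i - i`, which is
`e_δ` up to the shift by `δ / 2`. -/
def bead (μ : YoungDiagram) (i : ℕ) : ℤ := (μ.rowLen i : ℤ) - i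

/-- The set of beads of a Young diagram (its Maya diagram). -/
def beadSet (μ : YoungDiagram) : Set ℤ := Set.range (bead μ)

theorem bead_strictAnti (μ : YoungDiagram) : StrictAnti (bead μ) := by
  intro i j hij
  have := μ.rowLen_anti i j hij.le
  simp only [bead]
  omega

theorem beadSet_injective : Function.Injective beadSet := by
  intro μ ν h
  have hbead : bead μ = bead ν :=
    (StrictMono.range_inj (f := OrderDual.toDual ∘ bead μ) (g := OrderDual.toDual ∘ bead ν)
      (bead_strictAnti μ) (bead_strictAnti ν)).1 h
  ext ⟨i, j⟩
  have := congrFun hbead i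
  simp only [bead] at this
  rw [YoungDiagram.mem_cells, YoungDiagram.mem_cells, YoungDiagram.mem_iff_lt_rowLen,
    YoungDiagram.mem_iff_lt_rowLen]
  omega

theorem exists_bead_le (μ : YoungDiagram) (c : ℤ) : ∃ i, bead μ i ≤ c := by
  refine ⟨μ.rowLen 0 + c.natAbs, ?_⟩
  have := μ.rowLen_anti 0 (μ.rowLen 0 + c.natAbs) (Nat.zero_le _)
  simp only [bead]
  omega

open Classical in
/-- The number of beads greater than `c`. The boxes `(i, j)` of `μ` on the diagonal `j - i = c` are
exactly those in the rows `i < height μ c`. -/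
noncomputable def height (μ : YoungDiagram) (c : ℤ) : ℕ := Nat.find (exists_bead_le μ c)

theorem lt_height_iff {μ : YoungDiagram} {c : ℤ} {i : ℕ} : i < height μ c ↔ c < bead μ i := by
  classical
  rw [height, Nat.lt_find_iff]
  exact ⟨fun h => not_le.1 (h i le_rfl),
    fun h m hm => not_le.2 (h.trans_le ((bead_strictAnti μ).antitone hm))⟩

theorem mem_iff_lt_height {μ : YoungDiagram} {i j : ℕ} :
    (i, j) ∈ μ ↔ i < height μ ((j : ℤ) - i) := by
  rw [lt_height_iff, YoungDiagram.mem_iff_lt_rowLen, bead]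
  omega

theorem height_antitone (μ : YoungDiagram) : Antitone (height μ) := by
  intro c d h
  refine le_of_forall_lt fun i hi => ?_
  rw [lt_height_iff] at hi ⊢
  omega

theorem neg_le_height (μ : YoungDiagram) (c : ℤ) : -c ≤ height μ c := by
  by_contra! h
  have hirrefl : ¬ height μ c < height μ c := lt_irrefl _
  rw [lt_height_iff, bead] at hirrefl
  omega

theorem height_sub_one_of_mem {μ : YoungDiagram} {c : ℤ} (h : c ∈ beadSet μ) :
    height μ (c - 1) = height μ c + 1 := by
  obtain ⟨i, rfl⟩ := h
  have hc : ∀ k, k < height μ (bead μ i) ↔ k < i := fun k => by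
    rw [lt_height_iff, (bead_strictAnti μ).lt_iff_gt]
  have hc' : ∀ k, k < height μ (bead μ i - 1) ↔ k ≤ i := fun k => by
    rw [lt_height_iff, ← (bead_strictAnti μ).le_iff_ge, Int.sub_one_lt_iff]
  have := hc i
  have := hc (height μ (bead μ i))
  have := hc' i
  have := hc' (i + 1)
  omega

theorem height_sub_one_of_notMem {μ : YoungDiagram} {c : ℤ} (h : c ∉ beadSet μ) :
    height μ (c - 1) = height μ c := by
  refine le_antisymm (le_of_forall_lt fun i hi => ?_) (height_antitone μ (by omega))
  rw [lt_height_iff] at hi ⊢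
  have : bead μ i ≠ c := fun h' => h ⟨i, h'⟩
  omega

theorem mem_beadSet_iff {μ : YoungDiagram} {c : ℤ} :
    c ∈ beadSet μ ↔ height μ (c - 1) = height μ c + 1 := by
  refine ⟨height_sub_one_of_mem, fun h => ?_⟩
  by_contra h'
  have := height_sub_one_of_notMem h'
  omega

theorem height_sub_one_cases (μ : YoungDiagram) (c : ℤ) :
    height μ (c - 1) = height μ c ∨ height μ (c - 1) = height μ c + 1 := by
  by_cases h : c ∈ beadSet μ
  · exact Or.inr (height_sub_one_of_mem h)
  · exact Or.inl (height_sub_one_of_notMem h)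

theorem le_iff_height_le {μ ν : YoungDiagram} : μ ≤ ν ↔ ∀ c, height μ c ≤ height ν c := by
  constructor
  · intro h c
    refine le_of_forall_lt fun i hi => ?_
    by_cases hc : i + c < 0
    · have := neg_le_height ν c
      omega
    · have hcol : ((i + c).toNat : ℤ) - i = c := by omega
      rw [← hcol, ← mem_iff_lt_height] at hi ⊢
      exact h hi
  · rintro h ⟨i, j⟩ hij
    exact mem_iff_lt_height.2 ((mem_iff_lt_height.1 hij).trans_le (h _))

theorem exists_mem_iff_lt {h : ℤ → ℕ} (hanti : Antitone h)
    (hmono : Monotone fun c => (h c : ℤ) + c) (htop : ∃ c, h c = 0)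
    (hbot : ∃ c₀, ∀ c ≤ c₀, (h c : ℤ) + c = 0) :
    ∃ ν : YoungDiagram, ∀ i j : ℕ, (i, j) ∈ ν ↔ i < h ((j : ℤ) - i) := by
  obtain ⟨N, hN⟩ := htop
  obtain ⟨M, hM⟩ := hbot
  have hrows : ∀ i j : ℕ, i < h ((j : ℤ) - i) → i < h M ∧ j < (h M + N).toNat := by
    intro i j hij
    have hlt : (j : ℤ) - i < N := by
      by_contra! hle
      have := hanti hle
      omega
    have hgt : M < (j : ℤ) - i := by
      by_contra! hle
      have := hM _ hle
      omega
    have := hanti hgt.le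
    have := hM M le_rfl
    omega
  let ν : YoungDiagram :=
    { cells := {b ∈ Finset.range (h M) ×ˢ Finset.range (h M + N).toNat | b.1 < h ((b.2 : ℤ) - b.1)}
      isLowerSet := by
        rintro ⟨i, j⟩ ⟨i', j'⟩ ⟨hi, hj⟩ hmem
        simp only [Finset.coe_filter, Finset.mem_product, Finset.mem_range, Set.mem_ofPred_eq]
          at hi hj hmem ⊢
        suffices i' < h ((j' : ℤ) - i') from ⟨hrows _ _ this, this⟩
        have hcol := hmono (show (j : ℤ) - i ≤ (j : ℤ) - i' by omega)
        have hrow := hanti (show (j' : ℤ) - i' ≤ (j : ℤ) - i' by omega)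
        simp only at hcol
        omega }
  exact ⟨ν, fun i j => by simpa [ν, ← YoungDiagram.mem_cells] using hrows i j⟩

theorem exists_height_eq {h : ℤ → ℕ} (hanti : Antitone h) (hmono : Monotone fun c => (h c : ℤ) + c)
    (htop : ∃ c, h c = 0) (hbot : ∃ c₀, ∀ c ≤ c₀, (h c : ℤ) + c = 0) :
    ∃ ν : YoungDiagram, height ν = h := by
  obtain ⟨ν, hν⟩ := exists_mem_iff_lt hanti hmono htop hbot
  refine ⟨ν, funext fun c => eq_of_forall_lt_iff fun i => ?_⟩
  by_cases hc : i + c < 0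
  · obtain ⟨M, hM⟩ := hbot
    have := neg_le_height ν c
    have hle := hmono (min_le_left c M)
    have := hM _ (min_le_right c M)
    simp only at hle
    omega
  · have hcol : ((i + c).toNat : ℤ) - i = c := by omega
    rw [← hcol, ← mem_iff_lt_height, hν]

theorem exists_height_eq_zero (μ : YoungDiagram) : ∃ c₀, ∀ c ≥ c₀, height μ c = 0 := by
  refine ⟨bead μ 0, fun c hc => ?_⟩
  by_contra! h
  have := lt_height_iff.1 (Nat.pos_of_ne_zero h)
  omega

theorem exists_height_add_eq_zero (μ : YoungDiagram) :
    ∃ c₀, ∀ c ≤ c₀, (height μ c : ℤ) + c = 0 := by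
  refine ⟨-μ.colLen 0, fun c hc => ?_⟩
  have hlow := neg_le_height μ c
  suffices ¬ (-c).toNat < height μ c by omega
  rw [lt_height_iff, bead]
  have : (-c).toNat ∉ {i | (i, 0) ∈ μ} := by
    rw [Set.mem_ofPred_eq, YoungDiagram.mem_iff_lt_colLen]
    omega
  rw [Set.mem_ofPred_eq, YoungDiagram.mem_iff_lt_rowLen] at this
  omega

theorem exists_height_move (μ : YoungDiagram) {p q : ℤ} (hp : p ∈ beadSet μ)
    (hq : q ∉ beadSet μ) :
    ∃ ν : YoungDiagram,
      ∀ c, height ν c + (if c < p then 1 else 0) = height μ c + if c < q then 1 else 0 := by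
  have hp' := height_sub_one_of_mem hp
  have hq' := height_sub_one_of_notMem hq
  have hpq : p ≠ q := fun h => hq (h ▸ hp)
  let h : ℤ → ℕ := fun c => height μ c + (if c < q then 1 else 0) - if c < p then 1 else 0
  have hh : ∀ c, h c + (if c < p then 1 else 0) = height μ c + if c < q then 1 else 0 := fun c => by
    have : c < p → 0 < height μ c := fun hc => by
      have := height_antitone μ (show c ≤ p - 1 by omega)
      omega
    simp only [h]
    split_ifs <;> omega
  have hstep : ∀ c, h c ≤ h (c - 1) ∧ h (c - 1) ≤ h c + 1 := fun c => by
    have := hh c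
    have := hh (c - 1)
    have := height_sub_one_cases μ c
    rcases eq_or_ne c p with rfl | hcp <;> rcases eq_or_ne c q with rfl | hcq <;>
      split_ifs at * <;> omega
  have hstep' : ∀ c, h (c + 1) ≤ h c ∧ h c ≤ h (c + 1) + 1 := fun c => by
    simpa only [add_sub_cancel_right] using hstep (c + 1)
  obtain ⟨ctop, htop⟩ := exists_height_eq_zero μ
  obtain ⟨cbot, hbot⟩ := exists_height_add_eq_zero μ
  obtain ⟨ν, hν⟩ : ∃ ν : YoungDiagram, height ν = h := by
    refine exists_height_eq (antitone_int_of_succ_le fun c => (hstep' c).1)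
      (monotone_int_of_le_succ fun c => ?_)
      ⟨max ctop (max p q), ?_⟩ ⟨min cbot (min (p - 1) (q - 1)), fun c hc => ?_⟩
    · have := hstep' c
      omega
    · have := hh (max ctop (max p q))
      have := htop (max ctop (max p q)) (le_max_left _ _)
      split_ifs at * <;> omega
    · have := hh c
      have := hbot c (hc.trans (min_le_left _ _))
      split_ifs at * <;> omega
  exact ⟨ν, hν ▸ hh⟩

theorem beadSet_of_height_move {μ ν : YoungDiagram} {p q : ℤ} (hp : p ∈ beadSet μ)
    (hq : q ∉ beadSet μ)
    (h : ∀ c, height ν c + (if c < p then 1 else 0) = height μ c + if c < q then 1 else 0) :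
    beadSet ν = insert q (beadSet μ \ {p}) := by
  have hp' := height_sub_one_of_mem hp
  have hq' := height_sub_one_of_notMem hq
  ext c
  have := h c
  have := h (c - 1)
  rw [Set.mem_insert_iff, Set.mem_sdiff, Set.mem_singleton_iff, mem_beadSet_iff, mem_beadSet_iff]
  rcases eq_or_ne c p with rfl | hcp <;> rcases eq_or_ne c q with rfl | hcq <;>
    split_ifs at * <;> omega

theorem exists_move (μ : YoungDiagram) {p q : ℤ} (hp : p ∈ beadSet μ) (hq : q ∉ beadSet μ) :
    ∃ ν : YoungDiagram, beadSet ν = insert q (beadSet μ \ {p}) :=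
  let ⟨ν, hν⟩ := exists_height_move μ hp hq
  ⟨ν, beadSet_of_height_move hp hq hν⟩

section

open scoped Finset

/-- The content of a box, which labels the diagonal on which the box lies. -/
def content (b : ℕ × ℕ) : ℤ := (b.2 : ℤ) - b.1

theorem eq_of_content_eq_of_fst_eq {a b : ℕ × ℕ} (h : content a = content b) (h₁ : a.1 = b.1) :
    a = b := by
  simp only [content] at h
  exact Prod.ext h₁ (by omega)

theorem dualGraph_adj {R : Finset (ℕ × ℕ)} {a b : R} :
    (dualGraph R).Adj a b ↔
      (a.1.1 = b.1.1 ∧ (a.1.2 + 1 = b.1.2 ∨ b.1.2 + 1 = a.1.2)) ∨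
      (a.1.2 = b.1.2 ∧ (a.1.1 + 1 = b.1.1 ∨ b.1.1 + 1 = a.1.1)) := by
  rw [dualGraph, SimpleGraph.fromRel_adj, Ne, Subtype.ext_iff, Prod.ext_iff]
  omega

theorem content_of_dualGraph_adj {R : Finset (ℕ × ℕ)} {a b : R} (h : (dualGraph R).Adj a b) :
    content b.1 = content a.1 + 1 ∨ content b.1 = content a.1 - 1 := by
  rw [dualGraph_adj] at h
  simp only [content]
  omega

theorem IsSkew.ordConnected {R : Finset (ℕ × ℕ)} (h : IsSkew R) :
    (R : Set (ℕ × ℕ)).OrdConnected := by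
  obtain ⟨μ, ν, -, rfl⟩ := h
  refine ⟨fun a ha b hb x hx => ?_⟩
  rw [Finset.mem_coe, Finset.mem_sdiff] at ha hb ⊢
  exact ⟨ν.isLowerSet hx.2 hb.1, fun h => ha.2 (μ.isLowerSet hx.1 h)⟩

-- Two boxes on one diagonal would force a `2 × 2` square, a 4-cycle in the dual graph.
theorem IsRim.injOn_content {R : Finset (ℕ × ℕ)} (h : IsRim R) :
    Set.InjOn content (R : Set (ℕ × ℕ)) := by
  intro a ha b hb hab
  wlog hle : a.1 ≤ b.1 generalizing a b
  · exact (this hb ha hab.symm (by omega)).symm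
  refine eq_of_content_eq_of_fst_eq hab (hle.antisymm ?_)
  by_contra! hlt
  obtain ⟨hskew, n, ⟨f⟩⟩ := h
  obtain ⟨i, j⟩ := a
  obtain ⟨i', j'⟩ := b
  simp only [content] at hab hlt
  have hsquare : ∀ x y : ℕ, i ≤ x → x ≤ i + 1 → j ≤ y → y ≤ j + 1 → (x, y) ∈ R :=
    fun x y _ _ _ _ => hskew.ordConnected.out ha hb
      ⟨Prod.mk_le_mk.2 (by omega), Prod.mk_le_mk.2 (by omega)⟩
  let A : R := ⟨(i, j), ha⟩
  let B : R := ⟨(i + 1, j), hsquare _ _ (by omega) (by omega) (by omega) (by omega)⟩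
  let C : R := ⟨(i, j + 1), hsquare _ _ (by omega) (by omega) (by omega) (by omega)⟩
  let D : R := ⟨(i + 1, j + 1), hsquare _ _ (by omega) (by omega) (by omega) (by omega)⟩
  have hAB : (dualGraph R).Adj A B := by simp [dualGraph_adj, A, B]
  have hAC : (dualGraph R).Adj A C := by simp [dualGraph_adj, A, C]
  have hBD : (dualGraph R).Adj B D := by simp [dualGraph_adj, B, D]
  have hCD : (dualGraph R).Adj C D := by simp [dualGraph_adj, C, D]
  have hBC : f B ≠ f C := f.injective.ne (by simp [B, C])
  have hAD : f A ≠ f D := f.injective.ne (by simp [A, D])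
  rw [← f.map_adj_iff, SimpleGraph.pathGraph_adj] at hAB hAC hBD hCD
  rw [Ne, Fin.ext_iff] at hBC hAD
  omega

theorem IsRim.connected {R : Finset (ℕ × ℕ)} (h : IsRim R) : (dualGraph R).Connected :=
  let ⟨_, n, ⟨f⟩⟩ := h
  f.connected_iff.2 (SimpleGraph.pathGraph_connected n)

theorem exists_content_eq_of_connected {R : Finset (ℕ × ℕ)} (h : (dualGraph R).Connected)
    {a b : ℕ × ℕ} (ha : a ∈ R) (hb : b ∈ R) {c : ℤ} (hac : content a ≤ c) (hcb : c ≤ content b) :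
    ∃ x ∈ R, content x = c := by
  by_contra! hne
  have hstay : ∀ x y : R, (dualGraph R).Reachable x y → content x.1 < c → content y.1 < c := by
    rintro x y ⟨w⟩ hx
    induction w with
    | nil => exact hx
    | @cons _ v _ hadj _ ih =>
      refine ih ?_
      have := content_of_dualGraph_adj hadj
      have := hne v.1 v.2
      omega
  exact (hstay ⟨a, ha⟩ ⟨b, hb⟩ (h.preconnected _ _) (hac.lt_of_ne (hne a ha))).not_ge hcb

theorem IsRim.exists_content_card {R : Finset (ℕ × ℕ)} (h : IsRim R) :
    ∃ p q : ℤ, p < q ∧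
      ∀ c, #{b ∈ R | content b = c} = if p ≤ c ∧ c < q then 1 else 0 := by
  have hne : R.Nonempty := Finset.nonempty_coe_sort.1 h.connected.nonempty
  obtain ⟨a, ha, hmin⟩ := R.exists_min_image content hne
  obtain ⟨b, hb, hmax⟩ := R.exists_max_image content hne
  refine ⟨content a, content b + 1, by have := hmin b hb; omega, fun c => ?_⟩
  split_ifs with hc
  · obtain ⟨x, hx, rfl⟩ := exists_content_eq_of_connected h.connected ha hb hc.1 (by omega)
    refine Finset.card_eq_one.2 ⟨x, Finset.ext fun y => ?_⟩
    rw [Finset.mem_filter, Finset.mem_singleton]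
    exact ⟨fun hy => h.injOn_content hy.1 hx hy.2, by rintro rfl; exact ⟨hx, rfl⟩⟩
  · rw [Finset.card_eq_zero, Finset.filter_eq_empty_iff]
    rintro x hx rfl
    exact hc ⟨hmin x hx, Int.lt_add_one_of_le (hmax x hx)⟩

theorem mem_sdiff_iff_height {μ ν : YoungDiagram} {b : ℕ × ℕ} :
    b ∈ ν.cells \ μ.cells ↔ height μ (content b) ≤ b.1 ∧ b.1 < height ν (content b) := by
  rw [Finset.mem_sdiff, YoungDiagram.mem_cells, YoungDiagram.mem_cells, ← Prod.mk.eta (p := b),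
    mem_iff_lt_height, mem_iff_lt_height, not_lt, and_comm, content]

theorem exists_mem_sdiff_of_height {μ ν : YoungDiagram} {c : ℤ} {i : ℕ} (hμ : height μ c ≤ i)
    (hν : i < height ν c) : ∃ b ∈ ν.cells \ μ.cells, b.1 = i ∧ content b = c := by
  have hlow := neg_le_height μ c
  have hc : content (i, (i + c).toNat) = c := by
    simp only [content]
    omega
  exact ⟨(i, (i + c).toNat), mem_sdiff_iff_height.2 (by rw [hc]; exact ⟨hμ, hν⟩), rfl, hc⟩

theorem card_content_sdiff {μ ν : YoungDiagram} (c : ℤ) :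
    #{b ∈ ν.cells \ μ.cells | content b = c} = height ν c - height μ c := by
  rw [← Nat.card_Ico]
  refine Finset.card_bij (fun b _ => b.1) (fun b hb => ?_) (fun a ha b hb h => ?_) fun i hi => ?_
  · obtain ⟨hmem, rfl⟩ := Finset.mem_filter.1 hb
    exact Finset.mem_Ico.2 (mem_sdiff_iff_height.1 hmem)
  · exact eq_of_content_eq_of_fst_eq
      ((Finset.mem_filter.1 ha).2.trans (Finset.mem_filter.1 hb).2.symm) h
  · obtain ⟨hμ, hν⟩ := Finset.mem_Ico.1 hi
    obtain ⟨b, hb, hbi, hbc⟩ := exists_mem_sdiff_of_height hμ hν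
    exact ⟨b, Finset.mem_filter.2 ⟨hb, hbc⟩, hbi⟩

theorem dualGraph_adj_iff_content {μ : YoungDiagram} {R : Finset (ℕ × ℕ)}
    (hR : ∀ b ∈ R, b.1 = height μ (content b)) {a b : R} :
    (dualGraph R).Adj a b ↔ content b.1 = content a.1 + 1 ∨ content a.1 = content b.1 + 1 := by
  have ha := hR _ a.2
  have hb := hR _ b.2
  have hstepa := height_sub_one_cases μ (content a.1)
  have hstepb := height_sub_one_cases μ (content b.1)
  refine ⟨fun h => by have := content_of_dualGraph_adj h; omega, fun h => dualGraph_adj.2 ?_⟩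
  rcases h with h | h
  · rw [h, add_sub_cancel_right, ← h] at hstepb
    simp only [content] at *
    omega
  · rw [h, add_sub_cancel_right, ← h] at hstepa
    simp only [content] at *
    omega

theorem isRim_of_height_eq {μ ν : YoungDiagram} {p q : ℤ} (hpq : p < q)
    (h : ∀ c, height ν c = height μ c + if p ≤ c ∧ c < q then 1 else 0) :
    IsRim (ν.cells \ μ.cells) := by
  have hmem : ∀ b, b ∈ ν.cells \ μ.cells ↔
      (p ≤ content b ∧ content b < q) ∧ b.1 = height μ (content b) := fun b => by
    rw [mem_sdiff_iff_height, h]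
    split_ifs with hc <;> omega
  have hinj : ∀ a ∈ ν.cells \ μ.cells, ∀ b ∈ ν.cells \ μ.cells, content a = content b → a = b :=
    fun a ha b hb hab => eq_of_content_eq_of_fst_eq hab <| by
      rw [((hmem a).1 ha).2, ((hmem b).1 hb).2, hab]
  let f : (ν.cells \ μ.cells : Finset (ℕ × ℕ)) → Fin ((q - p).toNat - 1 + 1) :=
    fun b => ⟨(content b.1 - p).toNat, by have := ((hmem b.1).1 b.2).1; omega⟩
  have hf : ∀ b, ((f b : ℕ) : ℤ) = content b.1 - p := fun b => by
    have := ((hmem b.1).1 b.2).1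
    simp only [f]
    omega
  have hbij : Function.Bijective f := by
    refine ⟨fun a b hab => Subtype.ext (hinj _ a.2 _ b.2 ?_), fun k => ?_⟩
    · have := hf a
      have := hf b
      rw [hab] at *
      omega
    · have hk : height ν (p + k) = height μ (p + k) + 1 := by
        rw [h, if_pos (by omega)]
      obtain ⟨b, hb, -, hbc⟩ :=
        exists_mem_sdiff_of_height (ν := ν) (le_refl (height μ (p + k))) (by omega)
      exact ⟨⟨b, hb⟩, Fin.ext (by have : _ = content b - p := hf ⟨b, hb⟩; omega)⟩
  refine ⟨⟨μ, ν, le_iff_height_le.2 fun c => by rw [h]; omega, rfl⟩, _,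
    ⟨⟨Equiv.ofBijective f hbij, fun {a b} => ?_⟩⟩⟩
  have hfa := hf a
  have hfb := hf b
  rw [Equiv.ofBijective_apply, Equiv.ofBijective_apply, SimpleGraph.pathGraph_adj,
    dualGraph_adj_iff_content fun x hx => ((hmem x).1 hx).2]
  omega

end

section

open scoped Finset

variable {δ : ℤ} {μ ν : YoungDiagram}

/-- The boxes `b` and `b'` are exchanged by the `π`-rotation about the point of `δ`-charge `0` whose
row coordinate is `K / 2`. -/
def AreRotated (δ K : ℤ) (b b' : ℕ × ℕ) : Prop :=
  (b.1 : ℤ) + b'.1 = K ∧ content b + content b' = δ - 1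

theorem AreRotated.symm {K : ℤ} {b b' : ℕ × ℕ} (h : AreRotated δ K b b') :
    AreRotated δ K b' b :=
  ⟨by rw [add_comm]; exact h.1, by rw [add_comm]; exact h.2⟩

theorem piRotation_centre_eq_iff {x : ℝ × ℝ} (hx : charge δ x = 0) {K : ℤ} (hK : 2 * x.1 = K)
    {b b' : ℕ × ℕ} : piRotation x (centre b) = centre b' ↔ AreRotated δ K b b' := by
  have hcol : 2 * x.2 = ((K + δ - 1 : ℤ) : ℝ) := by
    simp only [charge] at hx
    push_cast
    linarith
  have hsub : ∀ (m : ℤ) (a a' : ℕ), (m : ℝ) - a = a' ↔ m - a = a' := fun m a a' => by norm_cast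
  rw [piRotation, centre, centre, Prod.mk.injEq, hK, hcol, hsub, hsub, AreRotated, content, content]
  omega

theorem image_piRotation_eq_iff {x : ℝ × ℝ} (hx : charge δ x = 0) {K : ℤ} (hK : 2 * x.1 = K)
    {R R' : Finset (ℕ × ℕ)} :
    piRotation x '' (centre '' (R : Set (ℕ × ℕ))) = centre '' (R' : Set (ℕ × ℕ)) ↔
      (∀ b ∈ R, ∃ b' ∈ R', AreRotated δ K b b') ∧ ∀ b' ∈ R', ∃ b ∈ R, AreRotated δ K b b' := by
  rw [Set.image_image, Set.Subset.antisymm_iff, Set.image_subset_iff, Set.image_subset_iff]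
  simp only [Set.subset_def, Set.mem_preimage, Set.mem_image, Finset.mem_coe,
    eq_comm (a := centre _), piRotation_centre_eq_iff hx hK]

theorem exists_intCast_eq_of_image_piRotation_eq {x : ℝ × ℝ} {R R' : Finset (ℕ × ℕ)}
    (hR : R.Nonempty)
    (h : piRotation x '' (centre '' (R : Set (ℕ × ℕ))) = centre '' (R' : Set (ℕ × ℕ))) :
    ∃ K : ℤ, 2 * x.1 = K := by
  obtain ⟨b, hb⟩ := hR
  obtain ⟨b', -, hb'⟩ : piRotation x (centre b) ∈ centre '' (R' : Set (ℕ × ℕ)) :=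
    h ▸ Set.mem_image_of_mem _ (Set.mem_image_of_mem _ hb)
  refine ⟨b.1 + b'.1, ?_⟩
  have := congrArg Prod.fst hb'
  simp only [centre, piRotation] at this
  push_cast
  linarith

theorem card_content_of_areRotated {K : ℤ} {R R' : Finset (ℕ × ℕ)}
    (hto : ∀ b ∈ R, ∃ b' ∈ R', AreRotated δ K b b')
    (hfrom : ∀ b' ∈ R', ∃ b ∈ R, AreRotated δ K b b') (c : ℤ) :
    #{b ∈ R' | content b = c} = #{b ∈ R | content b = δ - 1 - c} := by
  choose! f hf using hto
  refine (Finset.card_bij (fun b _ => f b) (fun b hb => ?_) (fun a ha b hb hab => ?_)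
    fun b' hb' => ?_).symm
  · rw [Finset.mem_filter] at hb ⊢
    obtain ⟨hmem, -, hcont⟩ := hf b hb.1
    exact ⟨hmem, by omega⟩
  · rw [Finset.mem_filter] at ha hb
    have hfa := (hf a ha.1).2.1
    have hfb := (hf b hb.1).2.1
    rw [hab] at hfa
    exact eq_of_content_eq_of_fst_eq (ha.2.trans hb.2.symm) (by omega)
  · rw [Finset.mem_filter] at hb'
    obtain ⟨b, hb, hrow, hcont⟩ := hfrom b' hb'.1
    obtain ⟨-, hrow', hcont'⟩ := hf b hb
    exact ⟨b, Finset.mem_filter.2 ⟨hb, by omega⟩,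
      eq_of_content_eq_of_fst_eq (by omega) (by omega)⟩

theorem height_add_height_of_areRotated {K : ℤ}
    (h : ∀ b ∈ ν.cells \ μ.cells, ∃ b' ∈ ν.cells \ μ.cells, AreRotated δ K b b') {c : ℤ}
    (hc : height μ c < height ν c) : (height μ c + height ν (δ - 1 - c) : ℤ) = K + 1 := by
  have hdual : ∀ c i, height μ c ≤ i → i < height ν c →
      (height μ (δ - 1 - c) : ℤ) ≤ K - i ∧ K - i < height ν (δ - 1 - c) := by
    intro c i hμ hν
    obtain ⟨b, hb, rfl, rfl⟩ := exists_mem_sdiff_of_height hμ hν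
    obtain ⟨b', hb', hrow, hcont⟩ := h b hb
    rw [mem_sdiff_iff_height, show content b' = δ - 1 - content b by omega] at hb'
    omega
  have htop := hdual c (height μ c) le_rfl hc
  have hbot := hdual (δ - 1 - c) (height ν (δ - 1 - c) - 1) (by omega) (by omega)
  rw [sub_sub_cancel] at hbot
  omega

/-- A minimal `δ`-balanced skew in terms of heights: its two rims occupy the diagonals
of contents `[p, q)` and `[δ - q, δ - p)`, and they are exchanged by `(i, c) ↦ (K - i, δ - 1 - c)`
in the coordinates (row, content). -/
structure IsBalancedShift (δ : ℤ) (μ ν : YoungDiagram) (p q K : ℤ) : Prop where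
  lt : p < q
  height_eq : ∀ c, height ν c = height μ c + (if p ≤ c ∧ c < q then 1 else 0) +
    if δ - q ≤ c ∧ c < δ - p then 1 else 0
  height_add : ∀ c, height μ c < height ν c → (height μ c + height ν (δ - 1 - c) : ℤ) = K + 1
  two_mul_ne : ∀ (c : ℤ) (i : ℕ), height μ c ≤ i → i < height ν c → 2 * (i : ℤ) ≠ K

theorem IsBalancedShift.symm {p q K : ℤ} (h : IsBalancedShift δ μ ν p q K) :
    IsBalancedShift δ μ ν (δ - q) (δ - p) K where
  lt := by have := h.lt; omega
  height_eq c := by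
    rw [h.height_eq, sub_sub_cancel, sub_sub_cancel]
    omega
  height_add := h.height_add
  two_mul_ne := h.two_mul_ne

-- Otherwise both rims would start on the same diagonal, and one bead cannot be removed twice.
theorem IsBalancedShift.add_ne {p q K : ℤ} (h : IsBalancedShift δ μ ν p q K) : p + q ≠ δ := by
  intro hδ
  have hlt := h.lt
  have hp := h.height_eq p
  have hp' := h.height_eq (p - 1)
  have := height_sub_one_cases μ p
  have := height_sub_one_cases ν p
  split_ifs at * <;> omega

theorem IsMinBalancedSkew.exists_isBalancedShift (h : IsMinBalancedSkew δ μ ν) :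
    ∃ p q K, δ < p + q ∧ IsBalancedShift δ μ ν p q K := by
  suffices ∃ p q K, IsBalancedShift δ μ ν p q K by
    obtain ⟨p, q, K, hshift⟩ := this
    rcases hshift.add_ne.lt_or_gt with hlt | hgt
    · exact ⟨δ - q, δ - p, K, by omega, hshift.symm⟩
    · exact ⟨p, q, K, hgt, hshift⟩
  obtain ⟨hle, R, R', hR, -, hdisj, hunion, x, hx, himage, hrow⟩ := h
  obtain ⟨p, q, hpq, hcard⟩ := hR.exists_content_card
  have hne : R.Nonempty := Finset.nonempty_coe_sort.1 hR.connected.nonempty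
  obtain ⟨K, hK⟩ := exists_intCast_eq_of_image_piRotation_eq hne himage
  obtain ⟨hto, hfrom⟩ := (image_piRotation_eq_iff hx hK).1 himage
  refine ⟨p, q, K, hpq, fun c => ?_, fun c hc => ?_, fun c i hμ hν h2 => ?_⟩
  · have hle' := le_iff_height_le.1 hle c
    have hsplit := card_content_sdiff (μ := μ) (ν := ν) c
    rw [hunion, Finset.filter_union,
      Finset.card_union_of_disjoint (Finset.disjoint_filter_filter hdisj),
      card_content_of_areRotated hto hfrom, hcard, hcard] at hsplit
    split_ifs at hsplit ⊢ <;> omega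
  · refine height_add_height_of_areRotated (fun b hb => ?_) hc
    rw [hunion] at hb ⊢
    rcases Finset.mem_union.1 hb with hb | hb
    · exact (hto b hb).imp fun b' hb' => ⟨Finset.mem_union_right _ hb'.1, hb'.2⟩
    · exact (hfrom b hb).imp fun b' hb' => ⟨Finset.mem_union_left _ hb'.1, hb'.2.symm⟩
  · obtain ⟨b, hb, rfl, -⟩ := exists_mem_sdiff_of_height hμ hν
    refine hrow b hb ?_
    simp only [piRotation, centre, hK, ← h2]
    push_cast
    ring

theorem exists_areRotated_of_height {κ κ' μ' : YoungDiagram} {K : ℤ} {b : ℕ × ℕ}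
    (hκ : height κ (content b) = height μ (content b) + 1)
    (hκ' : height μ' (δ - 1 - content b) < height κ' (δ - 1 - content b))
    (hK : (height μ (content b) + height μ' (δ - 1 - content b) : ℤ) = K)
    (hb : b ∈ κ.cells \ μ.cells) : ∃ b' ∈ κ'.cells \ μ'.cells, AreRotated δ K b b' := by
  obtain ⟨b', hb', hrow, hcont⟩ := exists_mem_sdiff_of_height le_rfl hκ'
  rw [mem_sdiff_iff_height] at hb
  exact ⟨b', hb', by omega, by omega⟩

theorem content_mem_of_height_eq {p q : ℤ} {b : ℕ × ℕ}
    (h : ∀ c, height ν c = height μ c + if p ≤ c ∧ c < q then 1 else 0)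
    (hb : b ∈ ν.cells \ μ.cells) : p ≤ content b ∧ content b < q := by
  rw [mem_sdiff_iff_height, h] at hb
  split_ifs at hb <;> omega

theorem IsBalancedShift.exists_areRotated {κ : YoungDiagram} {p q K : ℤ}
    (h : IsBalancedShift δ μ ν p q K)
    (hκ : ∀ c, height κ c = height μ c + if p ≤ c ∧ c < q then 1 else 0)
    (hν : ∀ c, height ν c = height κ c + if δ - q ≤ c ∧ c < δ - p then 1 else 0) :
    (∀ b ∈ κ.cells \ μ.cells, ∃ b' ∈ ν.cells \ κ.cells, AreRotated δ K b b') ∧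
      ∀ b' ∈ ν.cells \ κ.cells, ∃ b ∈ κ.cells \ μ.cells, AreRotated δ K b b' := by
  have hadd : ∀ c, p ≤ c → c < q → (height μ c + height κ (δ - 1 - c) : ℤ) = K := by
    intro c hpc hcq
    have hadd := h.height_add c (by rw [h.height_eq, if_pos ⟨hpc, hcq⟩]; omega)
    rw [hν, if_pos (by omega)] at hadd
    push_cast at hadd
    omega
  refine ⟨fun b hb => ?_, fun b' hb' => ?_⟩
  · obtain ⟨hpc, hcq⟩ := content_mem_of_height_eq hκ hb
    exact exists_areRotated_of_height (by rw [hκ, if_pos ⟨hpc, hcq⟩])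
      (by rw [hν, if_pos (by omega)]; exact Nat.lt_succ_self _) (hadd _ hpc hcq) hb
  · obtain ⟨hqc, hcp⟩ := content_mem_of_height_eq hν hb'
    have hmem : p ≤ δ - 1 - content b' ∧ δ - 1 - content b' < q := by omega
    have hsum := hadd _ hmem.1 hmem.2
    rw [sub_sub_cancel] at hsum
    obtain ⟨b, hb, hrot⟩ := exists_areRotated_of_height (κ := ν) (μ := κ) (κ' := κ) (μ' := μ)
      (by rw [hν, if_pos ⟨hqc, hcp⟩]) (by rw [hκ, if_pos hmem]; omega) (K := K)
      (by omega) hb'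
    exact ⟨b, hb, hrot.symm⟩

theorem IsBalancedShift.isMinBalancedSkew {κ : YoungDiagram} {p q K : ℤ}
    (h : IsBalancedShift δ μ ν p q K)
    (hκ : ∀ c, height κ c = height μ c + if p ≤ c ∧ c < q then 1 else 0) :
    IsMinBalancedSkew δ μ ν := by
  have hpq := h.lt
  have hν : ∀ c, height ν c = height κ c + if δ - q ≤ c ∧ c < δ - p then 1 else 0 :=
    fun c => by rw [h.height_eq, hκ]
  have hμκ : μ ≤ κ := le_iff_height_le.2 fun c => by rw [hκ]; omega
  have hκν : κ ≤ ν := le_iff_height_le.2 fun c => by rw [hν]; omega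
  have hx : charge δ ((K : ℝ) / 2, ((K : ℝ) + δ - 1) / 2) = 0 := by
    simp only [charge]
    ring
  have hK : 2 * ((K : ℝ) / 2, ((K : ℝ) + δ - 1) / 2).1 = K := by ring
  refine ⟨hμκ.trans hκν, κ.cells \ μ.cells, ν.cells \ κ.cells, isRim_of_height_eq hpq hκ,
    isRim_of_height_eq (by omega) hν, ?_, ?_, _, hx,
    (image_piRotation_eq_iff hx hK).2 (h.exists_areRotated hκ hν), ?_⟩
  · exact Finset.disjoint_left.2 fun b hb hb' =>
      (Finset.mem_sdiff.1 hb').2 (Finset.mem_sdiff.1 hb).1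
  · rw [Finset.union_comm]
    exact (Finset.sdiff_union_sdiff_cancel hκν hμκ).symm
  · intro b hb hfix
    rw [mem_sdiff_iff_height] at hb
    refine h.two_mul_ne _ _ hb.1 hb.2 ?_
    simp only [piRotation, centre, hK] at hfix
    exact_mod_cast (by linarith : (2 * b.1 : ℝ) = K)

end

section

variable {δ : ℤ} {μ ν : YoungDiagram}

/-- A minimal balanced skew in terms of bead sets: the bead `x` moves up to `y`, and the bead `r y`
moves up to `r x`, where `r` is an order-reversing involution. Between `x` and `y` the configuration
`D` is symmetric under `r`. It is used for the beads themselves, with `r b = δ - b`, and for the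
doubled entries of `e_δ`, with `r z = -z`. -/
structure IsBalancedMove {α : Type*} [LinearOrder α] (r : α → α) (D D' : Set α) (x y : α) :
    Prop where
  lt : x < y
  reflect_lt : r x < y
  mem : x ∈ D
  reflect_mem : r y ∈ D
  notMem : y ∉ D
  reflect_notMem : r x ∈ D → r x = x
  fixed_notMem : x < r x → ∀ z, r z = z → z ∉ D
  reflect_mem_iff : ∀ z, x < z → z < y → z ≠ r x → (z ∈ D ↔ r z ∈ D)
  eq_insert : D' = insert y (insert (r x) (D \ {x, r y}))

theorem isBalancedMove_image_iff {α β : Type*} [LinearOrder α] [LinearOrder β] {f : α → β}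
    (hf : StrictMono f) {r : α → α} {s : β → β} (hs : s.Involutive) (hfr : ∀ a, s (f a) = f (r a))
    {D D' : Set α} {x y : α} :
    IsBalancedMove s (f '' D) (f '' D') (f x) (f y) ↔ IsBalancedMove r D D' x y := by
  have hmem : ∀ {a}, f a ∈ f '' D ↔ a ∈ D := hf.injective.mem_set_image
  have heq : f '' insert y (insert (r x) (D \ {x, r y})) =
      insert (f y) (insert (f (r x)) (f '' D \ {f x, f (r y)})) := by
    rw [Set.image_insert_eq, Set.image_insert_eq, Set.image_sdiff hf.injective, Set.image_pair]
  constructor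
  · rintro ⟨hlt, hrlt, hx, hry, hy, hrx, hfix, hiff, hD'⟩
    simp only [hfr, hmem, hf.lt_iff_lt, hf.injective.eq_iff, ← heq]
      at hlt hrlt hx hry hy hrx hfix hD'
    refine ⟨hlt, hrlt, hx, hry, hy, hrx, fun h z hz => ?_, fun z hxz hzy hz => ?_,
      hf.injective.image_injective hD'⟩
    · exact fun hzD => hfix h (f z) (by rw [hfr, hz]) (Set.mem_image_of_mem f hzD)
    · rw [← hmem, hiff (f z) (hf hxz) (hf hzy) (by rwa [hfr, hf.injective.ne_iff]), hfr, hmem]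
  · rintro ⟨hlt, hrlt, hx, hry, hy, hrx, hfix, hiff, hD'⟩
    constructor <;> simp only [hfr, hmem, hf.lt_iff_lt, hf.injective.eq_iff, ← heq]
    iterate 6 assumption
    · rintro h _ hz ⟨a, ha, rfl⟩
      exact hfix h a (hf.injective (by rw [← hfr, hz])) ha
    · intro z hxz hzy hz
      by_cases hrange : z ∈ Set.range f
      · obtain ⟨a, rfl⟩ := hrange
        rw [hfr, hmem, hmem]
        exact hiff a (hf.lt_iff_lt.1 hxz) (hf.lt_iff_lt.1 hzy) fun h => hz (by rw [h])
      · refine iff_of_false (fun h => hrange (Set.image_subset_range _ _ h)) ?_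
        rintro ⟨a, -, ha⟩
        exact hrange ⟨r a, by rw [← hfr, ha, hs]⟩
    · rw [hD']

theorem height_eq_add_of_height_move {p q : ℤ} (hpq : p < q)
    (h : ∀ c, height ν c + (if c < p then 1 else 0) = height μ c + if c < q then 1 else 0) (c : ℤ) :
    height ν c = height μ c + if p ≤ c ∧ c < q then 1 else 0 := by
  have := h c
  split_ifs at * <;> omega

namespace IsBalancedShift

variable {p q K : ℤ}

theorem mem_iff (h : IsBalancedShift δ μ ν p q K) {c : ℤ} (hp : c ≠ p) (hq : c ≠ q)
    (hp' : c ≠ δ - p) (hq' : c ≠ δ - q) : c ∈ beadSet ν ↔ c ∈ beadSet μ := by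
  rw [mem_beadSet_iff, mem_beadSet_iff, h.height_eq, h.height_eq]
  split_ifs <;> omega

theorem mem_and_notMem (h : IsBalancedShift δ μ ν p q K) (hδ : δ < p + q) :
    (δ - q ∈ beadSet μ ∧ δ - q ∉ beadSet ν) ∧ q ∉ beadSet μ ∧ q ∈ beadSet ν := by
  have hlt := h.lt
  have hq := h.height_eq q
  have hq' := h.height_eq (q - 1)
  have hr := h.height_eq (δ - q)
  have hr' := h.height_eq (δ - q - 1)
  simp only [mem_beadSet_iff]
  have := height_sub_one_cases μ q
  have := height_sub_one_cases ν q
  have := height_sub_one_cases μ (δ - q)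
  have := height_sub_one_cases ν (δ - q)
  split_ifs at * <;> omega

theorem mem_and_notMem_of_two_mul_ne (h : IsBalancedShift δ μ ν p q K) (hδ : δ < p + q)
    (hp : 2 * p ≠ δ) :
    (p ∈ beadSet μ ∧ p ∉ beadSet ν) ∧ δ - p ∉ beadSet μ ∧ δ - p ∈ beadSet ν := by
  have hlt := h.lt
  have hp := h.height_eq p
  have hp' := h.height_eq (p - 1)
  have hr := h.height_eq (δ - p)
  have hr' := h.height_eq (δ - p - 1)
  simp only [mem_beadSet_iff]
  have := height_sub_one_cases μ p
  have := height_sub_one_cases ν p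
  have := height_sub_one_cases μ (δ - p)
  have := height_sub_one_cases ν (δ - p)
  split_ifs at * <;> omega

-- The skew has one box on each of the diagonals `p - 1` and `p`, which the rotation exchanges. If
-- they were in the same row, this row would be fixed.
theorem mem_of_two_mul_eq (h : IsBalancedShift δ μ ν p q K) (hp : 2 * p = δ) :
    p ∈ beadSet μ ∧ p ∈ beadSet ν := by
  have hlt := h.lt
  have hνp := h.height_eq p
  have hνp' := h.height_eq (p - 1)
  rw [if_pos (by omega), if_neg (by omega)] at hνp
  rw [if_neg (by omega), if_pos (by omega)] at hνp'
  have hadd := h.height_add p (by omega)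
  have hrow := h.two_mul_ne p (height μ p) le_rfl (by omega)
  rw [show δ - 1 - p = p - 1 by omega] at hadd
  have := height_sub_one_cases μ p
  simp only [mem_beadSet_iff]
  omega

theorem reflect_mem_iff (h : IsBalancedShift δ μ ν p q K) {c : ℤ} (hpc : p < c) (hcq : c < q) :
    c ∈ beadSet μ ↔ δ - c ∈ beadSet ν := by
  have hadd := h.height_add c (by rw [h.height_eq, if_pos (by omega)]; omega)
  have hadd' := h.height_add (c - 1) (by rw [h.height_eq, if_pos (by omega)]; omega)
  rw [sub_right_comm] at hadd
  rw [show δ - 1 - (c - 1) = δ - c by omega] at hadd'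
  rw [mem_beadSet_iff, mem_beadSet_iff]
  omega

-- Otherwise the rotation fixes the row of the middle bead, which meets the overlap of the rims.
theorem fixed_notMem (h : IsBalancedShift δ μ ν p q K) (hδ : δ < p + q) {c : ℤ} (hpc : p < c)
    (hc : δ - c = c) : c ∉ beadSet μ := by
  intro hmem
  have hνc := h.height_eq c
  have hνc' := h.height_eq (c - 1)
  rw [if_pos (by omega), if_pos (by omega)] at hνc hνc'
  have hadd := h.height_add c (by omega)
  rw [sub_right_comm, hc] at hadd
  have := height_sub_one_of_mem hmem
  exact h.two_mul_ne c (height μ c + 1) (by omega) (by omega) (by push_cast; omega)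

theorem isBalancedMove (h : IsBalancedShift δ μ ν p q K) (hδ : δ < p + q) :
    IsBalancedMove (δ - ·) (beadSet μ) (beadSet ν) p q := by
  have hlt := h.lt
  obtain ⟨⟨hrq, hrq'⟩, hq, hq'⟩ := h.mem_and_notMem hδ
  have hp : p ∈ beadSet μ ∧ δ - p ∈ beadSet ν := by
    rcases eq_or_ne (2 * p) δ with hp | hp
    · have := h.mem_of_two_mul_eq hp
      rwa [show δ - p = p by omega]
    · have := h.mem_and_notMem_of_two_mul_ne hδ hp
      exact ⟨this.1.1, this.2.2⟩
  have hrp : 2 * p ≠ δ → p ∉ beadSet ν ∧ δ - p ∉ beadSet μ := fun hne =>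
    ⟨(h.mem_and_notMem_of_two_mul_ne hδ hne).1.2, (h.mem_and_notMem_of_two_mul_ne hδ hne).2.1⟩
  refine ⟨hlt, by omega, hp.1, hrq, hq, fun hmem => ?_, fun hlt' z hz => ?_,
    fun z hpz hzq hz => ?_, Set.ext fun c => ?_⟩
  · by_contra hne
    exact (hrp (by omega)).2 hmem
  · exact h.fixed_notMem hδ (by omega) hz
  · rw [h.reflect_mem_iff hpz hzq]
    exact h.mem_iff (by omega) (by omega) (by omega) (by omega)
  · simp only [Set.mem_insert_iff, Set.mem_sdiff, Set.mem_singleton_iff]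
    by_cases hcq : c = q
    · simp [hcq, hq']
    by_cases hcrp : c = δ - p
    · simp [hcrp, hp.2]
    by_cases hcp : c = p
    · have : 2 * p ≠ δ := by omega
      simp [hcp, (hrp this).1, hlt.ne, show p ≠ δ - p by omega]
    by_cases hcrq : c = δ - q
    · simp [hcrq, hrq', show δ - q ≠ q by omega, show δ - q ≠ δ - p by omega]
    rw [h.mem_iff hcp hcq hcrp hcrq]
    tauto

end IsBalancedShift

namespace IsBalancedMove

variable {p q : ℤ}

theorem exists_height_eq (h : IsBalancedMove (δ - ·) (beadSet μ) (beadSet ν) p q) :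
    ∃ κ : YoungDiagram, (∀ c, height κ c = height μ c + if p ≤ c ∧ c < q then 1 else 0) ∧
      ∀ c, height ν c = height κ c + if δ - q ≤ c ∧ c < δ - p then 1 else 0 := by
  have hlt := h.lt
  have hrlt := h.reflect_lt
  obtain ⟨κ, hκ⟩ := exists_height_move μ h.mem h.notMem
  have hκ' := beadSet_of_height_move h.mem h.notMem hκ
  have hrq : δ - q ∈ beadSet κ := by
    rw [hκ']
    exact Or.inr ⟨h.reflect_mem, by rw [Set.mem_singleton_iff]; omega⟩
  have hrp : δ - p ∉ beadSet κ := by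
    rw [hκ']
    rintro (heq | ⟨hmem, hne⟩)
    · omega
    · exact hne (h.reflect_notMem hmem)
  obtain ⟨ν', hν'⟩ := exists_height_move κ hrq hrp
  obtain rfl : ν' = ν := by
    refine beadSet_injective ?_
    rw [beadSet_of_height_move hrq hrp hν', hκ', h.eq_insert]
    ext c
    simp only [Set.mem_insert_iff, Set.mem_sdiff, Set.mem_singleton_iff]
    have : c = q → c ≠ δ - q := by omega
    tauto
  exact ⟨κ, height_eq_add_of_height_move hlt hκ, height_eq_add_of_height_move (by omega) hν'⟩

theorem exists_height_add (h : IsBalancedMove (δ - ·) (beadSet μ) (beadSet ν) p q) :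
    ∃ K : ℤ, ∀ c, p ≤ c → c < q → (height μ c + height ν (δ - 1 - c) : ℤ) = K + 1 := by
  refine ⟨height μ p + height ν (δ - 1 - p) - 1, fun c hpc => ?_⟩
  induction c, hpc using Int.leInduction with
  | base => omega
  | succ c hpc ih =>
    intro hcq
    have hrlt := h.reflect_lt
    have hmem : c + 1 ∈ beadSet μ ↔ δ - (c + 1) ∈ beadSet ν := by
      rw [h.eq_insert]
      simp only [Set.mem_insert_iff, Set.mem_sdiff, Set.mem_singleton_iff, or_iff_right
        (show δ - (c + 1) ≠ q by omega), or_iff_right (show δ - (c + 1) ≠ δ - p by omega)]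
      rcases eq_or_ne (c + 1) (δ - p) with heq | hne
      · refine iff_of_false (fun hmem => ?_) fun hmem => hmem.2 (Or.inl (by omega))
        have := h.reflect_notMem (heq ▸ hmem)
        omega
      · rw [h.reflect_mem_iff _ (by omega) hcq hne]
        refine ⟨fun hmem => ⟨hmem, by omega⟩, And.left⟩
    have := height_sub_one_cases μ (c + 1)
    have := height_sub_one_cases ν (δ - (c + 1))
    rw [mem_beadSet_iff, mem_beadSet_iff] at hmem
    rw [add_sub_cancel_right] at *
    rw [show δ - (c + 1) - 1 = δ - 1 - (c + 1) by omega, show δ - (c + 1) = δ - 1 - c by omega] at *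
    have := ih (by omega)
    omega

-- The middle of the overlap of the two rims lies between two rows.
theorem odd_of_height_add (h : IsBalancedMove (δ - ·) (beadSet μ) (beadSet ν) p q)
    (hp : 2 * p < δ) (hν : ∀ c, p ≤ c → c < δ - p → height ν c = height μ c + 2) {K : ℤ}
    (hK : ∀ c, p ≤ c → c < q → (height μ c + height ν (δ - 1 - c) : ℤ) = K + 1) : Odd K := by
  have hrlt := h.reflect_lt
  obtain ⟨m, rfl | rfl⟩ := Int.even_or_odd' δ
  · have hm : m ∉ beadSet μ := h.fixed_notMem (by omega) m (by omega)
    have := height_sub_one_of_notMem hm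
    have hadd := hK m (by omega) (by omega)
    rw [show 2 * m - 1 - m = m - 1 by omega, hν _ (by omega) (by omega)] at hadd
    exact ⟨height μ m, by push_cast at hadd; omega⟩
  · have hadd := hK m (by omega) (by omega)
    rw [show 2 * m + 1 - 1 - m = m by omega, hν _ (by omega) (by omega)] at hadd
    exact ⟨height μ m, by push_cast at hadd; omega⟩

theorem height_lt_height (h : IsBalancedMove (δ - ·) (beadSet μ) (beadSet ν) p q) {c d : ℤ}
    (hc : c < p) (hd : p ≤ d) : height μ d < height μ c := by
  have := height_sub_one_of_mem h.mem
  have := height_antitone μ (show c ≤ p - 1 by omega)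
  have := height_antitone μ hd
  omega

theorem isMinBalancedSkew (h : IsBalancedMove (δ - ·) (beadSet μ) (beadSet ν) p q) :
    IsMinBalancedSkew δ μ ν := by
  have hrlt := h.reflect_lt
  obtain ⟨κ, hκ, hκν⟩ := h.exists_height_eq
  obtain ⟨K, hK⟩ := h.exists_height_add
  have hν : ∀ c, height ν c = height μ c + (if p ≤ c ∧ c < q then 1 else 0) +
      if δ - q ≤ c ∧ c < δ - p then 1 else 0 := fun c => by rw [hκν, hκ]
  have hadd : ∀ c, height μ c < height ν c →
      (height μ c + height ν (δ - 1 - c) : ℤ) = K + 1 := by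
    intro c hc
    have hνc := hν c
    by_cases hpc : p ≤ c ∧ c < q
    · exact hK c hpc.1 hpc.2
    · have hνc' := hν (δ - 1 - c)
      have := hK (δ - 1 - c) (by split_ifs at * <;> omega) (by split_ifs at * <;> omega)
      rw [sub_sub_cancel] at this
      split_ifs at * <;> omega
  refine IsBalancedShift.isMinBalancedSkew ⟨h.lt, hν, hadd, fun c i hμi hνi h2 => ?_⟩ hκ
  by_cases hp : 2 * p < δ
  · have hodd := h.odd_of_height_add hp
      (fun c hpc hcp => by rw [hν, if_pos (by omega), if_pos (by omega)]) hK
    exact Int.not_even_iff_odd.2 hodd ⟨i, by omega⟩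
  · have hνc := hν c
    have hνc' := hν (δ - 1 - c)
    have := hadd c (by omega)
    rcases lt_or_ge c p with hcp | hpc
    · have := h.height_lt_height hcp (d := δ - 1 - c) (by split_ifs at * <;> omega)
      split_ifs at * <;> omega
    · have := h.height_lt_height (c := δ - 1 - c) (by omega) hpc
      split_ifs at * <;> omega

end IsBalancedMove

theorem isMinBalancedSkew_iff_beadSet :
    IsMinBalancedSkew δ μ ν ↔
      ∃ p q, IsBalancedMove (δ - ·) (beadSet μ) (beadSet ν) p q := by
  refine ⟨fun h => ?_, fun ⟨p, q, h⟩ => h.isMinBalancedSkew⟩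
  obtain ⟨p, q, K, hδ, hshift⟩ := h.exists_isBalancedShift
  exact ⟨p, q, hshift.isBalancedMove hδ⟩

end

section

variable {δ : ℤ} {μ : YoungDiagram} {D : Set ℤ} {M : Set ℕ}

/-- The set of the doubled entries of `e_δ(μ)`. -/
def dblSet (δ : ℤ) (μ : YoungDiagram) : Set ℤ := (2 * · - δ) '' beadSet μ

/-- The magnitudes of the elements of `D` that survive the removal of all doubletons `{z, -z}`. The
two terms of a doubleton are at distinct places, so that `0` survives. -/
def singleMags (D : Set ℤ) : Set ℕ :=
  {k | ((k : ℤ) ∈ D ∨ -(k : ℤ) ∈ D) ∧ ((k : ℤ) ∈ D → -(k : ℤ) ∈ D → k = 0)}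

/-- The single magnitudes that occur with positive sign. -/
def posMags (D : Set ℤ) : Set ℕ := {k | (k : ℤ) ∈ D ∧ -(k : ℤ) ∉ D}

/-- The single magnitudes to which the map `o` gives a positive sign: those with positive sign, and
`0` if this makes their number even. -/
def upMags (D : Set ℤ) : Set ℕ :=
  {k | k ∈ posMags D ∨ (k = 0 ∧ (0 : ℤ) ∈ D ∧ Odd (posMags D).ncard)}

theorem strictMono_two_mul_sub (δ : ℤ) : StrictMono (2 * · - δ : ℤ → ℤ) := fun _ _ h => by
  dsimp only
  omega

theorem dblSet_injective (δ : ℤ) : Function.Injective (dblSet δ) :=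
  (strictMono_two_mul_sub δ).injective.image_injective.comp beadSet_injective

theorem dblSet_eq_range (δ : ℤ) (μ : YoungDiagram) :
    dblSet δ μ = Set.range fun i => 2 * bead μ i - δ :=
  (Set.range_comp _ _).symm

theorem two_mul_bead_sub_mem (δ : ℤ) (μ : YoungDiagram) (i : ℕ) :
    2 * bead μ i - δ ∈ dblSet δ μ :=
  ⟨_, ⟨i, rfl⟩, rfl⟩

theorem two_mul_bead_sub_strictAnti (δ : ℤ) (μ : YoungDiagram) :
    StrictAnti fun i => 2 * bead μ i - δ :=
  (strictMono_two_mul_sub δ).comp_strictAnti (bead_strictAnti μ)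

theorem eMap_eq_div_two (δ : ℤ) (μ : YoungDiagram) (i : ℕ) :
    eMap δ μ i = ((2 * bead μ i - δ : ℤ) : ℝ) / 2 := by
  simp only [eMap, bead]
  push_cast
  ring

theorem zero_notMem_posMags : 0 ∉ posMags D := by
  simp [posMags]

theorem zero_mem_singleMags_iff : 0 ∈ singleMags D ↔ (0 : ℤ) ∈ D := by
  simp [singleMags]

theorem posMags_subset_singleMags : posMags D ⊆ singleMags D :=
  fun _ h => ⟨Or.inl h.1, fun _ hneg => absurd hneg h.2⟩

theorem upMags_subset_singleMags : upMags D ⊆ singleMags D := by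
  rintro k (h | ⟨rfl, h, -⟩)
  · exact posMags_subset_singleMags h
  · exact zero_mem_singleMags_iff.2 h

theorem mem_upMags_of_pos {k : ℕ} (hk : 0 < k) : k ∈ upMags D ↔ k ∈ posMags D :=
  or_iff_left fun h => hk.ne' h.1

theorem natAbs_mem_singleMags_iff {z : ℤ} (hz : z ∈ D) :
    z.natAbs ∈ singleMags D ↔ (-z ∈ D → z = 0) := by
  obtain ⟨k, rfl | rfl⟩ := z.eq_nat_or_neg <;> simp [singleMags] at * <;> tauto

theorem natAbs_mem_posMags_iff {z : ℤ} (hz : z ∈ D) (h : z.natAbs ∈ singleMags D) :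
    z.natAbs ∈ posMags D ↔ 0 < z := by
  rw [natAbs_mem_singleMags_iff hz] at h
  obtain ⟨k, rfl | rfl⟩ := z.eq_nat_or_neg <;> simp [posMags] at * <;> grind

theorem exists_natAbs_eq_of_mem_singleMags {k : ℕ} (hk : k ∈ singleMags D) :
    ∃ z ∈ D, z.natAbs = k := by
  rcases hk.1 with h | h
  · exact ⟨k, h, Int.natAbs_natCast k⟩
  · exact ⟨-k, h, by rw [Int.natAbs_neg, Int.natAbs_natCast]⟩

theorem injOn_natAbs : {z ∈ D | z.natAbs ∈ singleMags D}.InjOn Int.natAbs := by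
  rintro z ⟨hz, hzs⟩ w ⟨hw, -⟩ h
  rcases Int.natAbs_eq_natAbs_iff.1 h with h | rfl
  · exact h
  · have := (natAbs_mem_singleMags_iff hz).1 hzs (by rwa [neg_neg])
    omega

theorem posMags_finite (hD : BddAbove D) : (posMags D).Finite := by
  obtain ⟨N, hN⟩ := hD
  refine (Set.finite_Iic N.toNat).subset fun k hk => ?_
  have := hN hk.1
  rw [Set.mem_Iic]
  omega

theorem upMags_finite (hD : BddAbove D) : (upMags D).Finite := by
  refine ((posMags_finite hD).insert 0).subset ?_
  rintro k (h | ⟨rfl, -⟩)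
  · exact Or.inr h
  · exact Or.inl rfl

theorem upMags_of_odd (h0 : (0 : ℤ) ∈ D) (hodd : Odd (posMags D).ncard) :
    upMags D = insert 0 (posMags D) := by
  ext k
  simp only [upMags, Set.mem_ofPred_eq, Set.mem_insert_iff]
  tauto

theorem upMags_of_even (heven : Even (posMags D).ncard) : upMags D = posMags D := by
  ext k
  simp only [upMags, Set.mem_ofPred_eq, ← Nat.not_even_iff_odd]
  tauto

theorem even_ncard_upMags (hD : BddAbove D) (h0 : (0 : ℤ) ∈ D) : Even (upMags D).ncard := by
  rcases Nat.even_or_odd (posMags D).ncard with heven | hodd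
  · rwa [upMags_of_even heven]
  · rw [upMags_of_odd h0 hodd,
      Set.ncard_insert_of_notMem zero_notMem_posMags (posMags_finite hD)]
    exact hodd.add_one

theorem bddAbove_dblSet (δ : ℤ) (μ : YoungDiagram) : BddAbove (dblSet δ μ) := by
  rw [dblSet_eq_range]
  exact ⟨_, Set.forall_mem_range.2 fun i =>
    (two_mul_bead_sub_strictAnti δ μ).antitone (Nat.zero_le i)⟩

theorem isolated_iff (i : ℕ) :
    (∀ j, j ≠ i → eMap δ μ j ≠ -eMap δ μ i) ↔
      (2 * bead μ i - δ).natAbs ∈ singleMags (dblSet δ μ) := by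
  have hinj := (two_mul_bead_sub_strictAnti δ μ).injective
  have heMap : ∀ j, eMap δ μ j = -eMap δ μ i ↔ 2 * bead μ j - δ = -(2 * bead μ i - δ) := by
    intro j
    rw [eMap_eq_div_two, eMap_eq_div_two, ← neg_div, div_left_inj' two_ne_zero]
    exact_mod_cast Iff.rfl
  rw [natAbs_mem_singleMags_iff (two_mul_bead_sub_mem δ μ i), dblSet_eq_range, Set.mem_range,
    forall_exists_index]
  refine forall_congr' fun j => ?_
  rw [ne_eq (eMap δ μ j), heMap]
  constructor
  · intro h hj
    by_contra hne
    exact h (fun hji => hne (by subst hji; omega)) hj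
  · intro h hne hj
    exact hne (hinj (by have := h hj; dsimp only; omega))

theorem infinite_isolated (δ : ℤ) (μ : YoungDiagram) :
    {i | ∀ j, j ≠ i → eMap δ μ j ≠ -eMap δ μ i}.Infinite := by
  refine (Set.Ioi_infinite (2 * bead μ 0 - δ).natAbs).mono fun i hi => ?_
  simp only [Set.mem_Ioi, Set.mem_ofPred_eq, isolated_iff] at hi ⊢
  rw [natAbs_mem_singleMags_iff (two_mul_bead_sub_mem δ μ i)]
  rintro ⟨_, ⟨j, rfl⟩, hj⟩
  have hbead : bead μ j ≤ bead μ 0 := (bead_strictAnti μ).antitone (Nat.zero_le j)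
  have := μ.rowLen_anti 0 i (Nat.zero_le _)
  simp only [bead] at *
  omega

theorem exists_regularize_eq (δ : ℤ) (μ : YoungDiagram) :
    ∃ z : ℕ → ℤ, (∀ j, regularize (eMap δ μ) j = (z j : ℝ) / 2) ∧
      Function.Injective (fun j => (z j).natAbs) ∧
      Set.range (fun j => (z j).natAbs) = singleMags (dblSet δ μ) ∧ ∀ j, z j ∈ dblSet δ μ := by
  have hinf := infinite_isolated δ μ
  set σ := Nat.nth fun i => ∀ j, j ≠ i → eMap δ μ j ≠ -eMap δ μ i
  have hmem := two_mul_bead_sub_mem δ μ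
  have hsingle : ∀ j, (2 * bead μ (σ j) - δ).natAbs ∈ singleMags (dblSet δ μ) := fun j =>
    (isolated_iff _).1 (Nat.nth_mem_of_infinite hinf j)
  refine ⟨fun j => 2 * bead μ (σ j) - δ, fun j => eMap_eq_div_two _ _ _, fun i j h => ?_,
    (Set.range_subset_iff.2 hsingle).antisymm fun k hk => ?_, fun j => hmem _⟩
  · exact Nat.nth_injective hinf ((two_mul_bead_sub_strictAnti δ μ).injective
      (injOn_natAbs ⟨hmem _, hsingle i⟩ ⟨hmem _, hsingle j⟩ h))
  · obtain ⟨_, ⟨_, ⟨i, rfl⟩, rfl⟩, rfl⟩ := exists_natAbs_eq_of_mem_singleMags hk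
    obtain ⟨j, rfl⟩ : i ∈ Set.range σ := by
      rw [Nat.range_nth_of_infinite hinf]
      exact (isolated_iff i).2 hk
    exact ⟨j, rfl⟩

theorem singleMags_infinite (δ : ℤ) (μ : YoungDiagram) : (singleMags (dblSet δ μ)).Infinite := by
  obtain ⟨z, -, hinj, hrange, -⟩ := exists_regularize_eq δ μ
  exact hrange ▸ Set.infinite_range_of_injective hinj

/-- The `n`-th element of an infinite set of natural numbers, where `n` is counted from `1`. -/
noncomputable def place (M : Set ℕ) (n : ℕ+) : ℕ := Nat.nth (· ∈ M) n.natPred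

theorem place_strictMono (hM : M.Infinite) : StrictMono (place M) :=
  (Nat.nth_strictMono hM).comp PNat.natPred_strictMono

theorem range_place (hM : M.Infinite) : Set.range (place M) = M :=
  (Equiv.pnatEquivNat.surjective.range_comp _).trans (Nat.range_nth_of_infinite hM)

theorem place_mem (hM : M.Infinite) (n : ℕ+) : place M n ∈ M :=
  Nat.nth_mem_of_infinite (p := (· ∈ M)) hM _

theorem exists_place_eq (hM : M.Infinite) {k : ℕ} (hk : k ∈ M) : ∃ n, place M n = k := by
  rwa [← Set.mem_range, range_place hM]

theorem ncard_le_place (hM : M.Infinite) (n : ℕ+) : {k ∈ M | k ≤ place M n}.ncard = n := by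
  have himage : {k ∈ M | k ≤ place M n} = place M '' (Finset.Icc 1 n : Finset ℕ+) := by
    ext k
    constructor
    · rintro ⟨hk, hle⟩
      obtain ⟨m, rfl⟩ := exists_place_eq hM hk
      exact ⟨m, by simpa using (place_strictMono hM).le_iff_le.1 hle, rfl⟩
    · rintro ⟨m, hm, rfl⟩
      exact ⟨place_mem hM m, (place_strictMono hM).monotone (Finset.mem_Icc.1 hm).2⟩
  rw [himage, Set.ncard_image_of_injective _ (place_strictMono hM).injective,
    Set.ncard_coe_finset, PNat.card_Icc]
  simp

theorem ncard_abs_le {v : ℕ → ℝ} {z : ℕ → ℤ} (hv : ∀ j, v j = (z j : ℝ) / 2)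
    (hinj : Function.Injective fun j => (z j).natAbs) {i : ℕ} {n : ℕ+}
    (hn : place (Set.range fun j => (z j).natAbs) n = (z i).natAbs) :
    {j | |v j| ≤ |v i|}.ncard = n := by
  have hle : ∀ j, |v j| ≤ |v i| ↔ (z j).natAbs ≤ (z i).natAbs := fun j => by
    rw [hv, hv, abs_div, abs_div, div_le_div_iff_of_pos_right (by positivity), ← Int.cast_abs,
      ← Int.cast_abs, Int.cast_le, Int.abs_eq_natAbs, Int.abs_eq_natAbs, Int.ofNat_le]
  rw [← ncard_le_place (Set.infinite_range_of_injective hinj) n, hn,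
    ← Set.ncard_image_of_injective _ hinj]
  congr 1
  ext k
  simp only [hle, Set.mem_image, Set.mem_ofPred_eq, Set.mem_range]
  constructor
  · rintro ⟨j, hj, rfl⟩
    exact ⟨⟨j, rfl⟩, hj⟩
  · rintro ⟨⟨j, rfl⟩, hj⟩
    exact ⟨j, hj, rfl⟩

theorem mem_positiveTerms_signedRank_iff {v : ℕ → ℝ} {z : ℕ → ℤ} (hv : ∀ j, v j = (z j : ℝ) / 2)
    (hinj : Function.Injective fun j => (z j).natAbs) {n : ℕ+} :
    n ∈ positiveTerms (signedRank v) ↔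
      ∃ i, place (Set.range fun j => (z j).natAbs) n = (z i).natAbs ∧
        (0 < z i ∨ (z i = 0 ∧ Odd {j | 0 < z j}.ncard)) := by
  have hM := Set.infinite_range_of_injective hinj
  have hpos : ∀ j, 0 < v j ↔ 0 < z j := fun j => by
    rw [hv, div_pos_iff_of_pos_right two_pos, Int.cast_pos]
  have hzero : ∀ j, v j = 0 ↔ z j = 0 := fun j => by simp [hv]
  refine exists_congr fun i => ?_
  obtain ⟨m, hm⟩ := exists_place_eq hM ⟨i, rfl⟩
  simp only [signedRank, hpos, hzero, ncard_abs_le hv hinj hm, ← hm,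
    (place_strictMono hM).injective.eq_iff]
  have hn := n.pos
  split_ifs with h
  · rw [and_iff_left h, Nat.cast_inj, PNat.coe_inj, eq_comm]
  · exact iff_of_false (by omega) fun hi => h hi.2

theorem mem_untoggled_iff {n : ℕ+} :
    n ∈ untoggled δ μ ↔ place (singleMags (dblSet δ μ)) n ∈ upMags (dblSet δ μ) := by
  obtain ⟨z, hv, hinj, hrange, hmem⟩ := exists_regularize_eq δ μ
  have hpos : ∀ i, 0 < z i ↔ (z i).natAbs ∈ posMags (dblSet δ μ) := fun i =>
    (natAbs_mem_posMags_iff (hmem i) (hrange ▸ ⟨i, rfl⟩)).symm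
  have hncard : {j | 0 < z j}.ncard = (posMags (dblSet δ μ)).ncard := by
    rw [← Set.ncard_image_of_injective _ hinj]
    simp only [hpos]
    congr 1
    exact Set.image_preimage_eq_of_subset (hrange ▸ posMags_subset_singleMags)
  rw [untoggled, mem_positiveTerms_signedRank_iff hv hinj, hrange, hncard]
  constructor
  · rintro ⟨i, hi, h | ⟨h, hodd⟩⟩
    · exact Or.inl (hi ▸ (hpos i).1 h)
    · exact Or.inr ⟨by rw [hi, h, Int.natAbs_zero], h ▸ hmem i, hodd⟩
  · intro h
    obtain ⟨i, hi : (z i).natAbs = _⟩ :=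
      hrange.symm.subset (place_mem (singleMags_infinite δ μ) n)
    refine ⟨i, hi.symm, ?_⟩
    rw [← hi] at h
    exact h.imp (hpos i).2 fun h => ⟨Int.natAbs_eq_zero.1 h.1, h.2.2⟩

theorem image_place_untoggled (δ : ℤ) (μ : YoungDiagram) :
    place (singleMags (dblSet δ μ)) '' untoggled δ μ = upMags (dblSet δ μ) := by
  have hpreimage : untoggled δ μ = place (singleMags (dblSet δ μ)) ⁻¹' upMags (dblSet δ μ) :=
    Set.ext fun _ => mem_untoggled_iff
  rw [hpreimage, Set.image_preimage_eq_of_subset]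
  rw [range_place (singleMags_infinite δ μ)]
  exact upMags_subset_singleMags

theorem untoggled_finite (δ : ℤ) (μ : YoungDiagram) : (untoggled δ μ).Finite := by
  refine Set.Finite.of_finite_image ?_ (place_strictMono (singleMags_infinite δ μ)).injective.injOn
  rw [image_place_untoggled]
  exact upMags_finite (bddAbove_dblSet δ μ)

theorem even_ncard_untoggled (h : 0 ∈ singleMags (dblSet δ μ)) :
    Even (untoggled δ μ).ncard := by
  rw [← Set.ncard_image_of_injective _ (place_strictMono (singleMags_infinite δ μ)).injective,
    image_place_untoggled]
  exact even_ncard_upMags (bddAbove_dblSet δ μ) (zero_mem_singleMags_iff.1 h)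

end

section

variable {δ : ℤ} {μ ν : YoungDiagram} {D D' : Set ℤ}

/-- The sets `D` and `D'` become equal when the signs of the single magnitudes are forgotten. For
the sets of entries of `e_δ` this says that the partitions are in the same orbit of the group of
all signed permutations. -/
def SameCore (D D' : Set ℤ) : Prop :=
  ∀ z, (z ∈ D ∧ -z ∈ D ↔ z ∈ D' ∧ -z ∈ D') ∧ (z ∈ D ∨ -z ∈ D ↔ z ∈ D' ∨ -z ∈ D')

namespace SameCore

theorem refl (D : Set ℤ) : SameCore D D := fun _ => ⟨Iff.rfl, Iff.rfl⟩

theorem symm (h : SameCore D D') : SameCore D' D := fun z => ⟨(h z).1.symm, (h z).2.symm⟩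

theorem trans {D'' : Set ℤ} (h : SameCore D D') (h' : SameCore D' D'') : SameCore D D'' :=
  fun z => ⟨(h z).1.trans (h' z).1, (h z).2.trans (h' z).2⟩

theorem zero_mem_iff (h : SameCore D D') : 0 ∈ D ↔ 0 ∈ D' := by
  simpa using (h 0).1

theorem singleMags_eq (h : SameCore D D') : singleMags D = singleMags D' := by
  ext k
  have := h k
  simp only [singleMags, Set.mem_ofPred_eq]
  tauto

theorem eq_of_posMags_eq (h : SameCore D D') (hpos : posMags D = posMags D') : D = D' := by
  ext z
  have hcore := h z
  have hmem := Set.ext_iff.1 hpos z.natAbs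
  obtain ⟨k, rfl | rfl⟩ := z.eq_nat_or_neg <;>
    simp only [posMags, Set.mem_ofPred_eq, Int.natAbs_neg, Int.natAbs_natCast, neg_neg]
      at hcore hmem ⊢ <;>
    tauto

theorem eq_of_upMags_eq (h : SameCore D D') (hup : upMags D = upMags D') : D = D' := by
  refine h.eq_of_posMags_eq (Set.ext fun k => ?_)
  rcases Nat.eq_zero_or_pos k with rfl | hk
  · exact iff_of_false zero_notMem_posMags zero_notMem_posMags
  · rw [← mem_upMags_of_pos hk, hup, mem_upMags_of_pos hk]

end SameCore

theorem natAbs_mem_singleMags_of_not_iff {z : ℤ} (h : ¬ (z ∈ D ↔ -z ∈ D)) :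
    z.natAbs ∈ singleMags D := by
  obtain ⟨k, rfl | rfl⟩ := z.eq_nat_or_neg <;> simp [singleMags] at * <;> tauto

/-- The set `D` after a change of the sign of its element `z`. -/
def negate (D : Set ℤ) (z : ℤ) : Set ℤ := insert (-z) (D \ {z})

theorem mem_negate_iff {z w : ℤ} : w ∈ negate D z ↔ w = -z ∨ (w ∈ D ∧ w ≠ z) := Iff.rfl

theorem sameCore_negate {z : ℤ} (hz : z ∈ D) (hsingle : z.natAbs ∈ singleMags D) :
    SameCore D (negate D z) := by
  rw [natAbs_mem_singleMags_iff hz] at hsingle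
  intro w
  simp only [mem_negate_iff]
  by_cases hwz : w = z
  · subst hwz
    grind
  · grind

theorem posMags_negate {z : ℤ} (hz : z ∈ D) (hsingle : z.natAbs ∈ singleMags D) (h0 : z ≠ 0) :
    posMags (negate D z) = symmDiff (posMags D) {z.natAbs} := by
  rw [natAbs_mem_singleMags_iff hz] at hsingle
  ext k
  simp only [posMags, Set.mem_ofPred_eq, mem_negate_iff, Set.mem_symmDiff, Set.mem_singleton_iff]
  grind

theorem negate_zero (h0 : (0 : ℤ) ∈ D) : negate D 0 = D := by
  simp [negate, Set.insert_eq_of_mem h0]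

theorem even_ncard_symmDiff_singleton {α : Type*} {s : Set α} (hs : s.Finite) (x : α) :
    Even (symmDiff s {x}).ncard ↔ ¬ Even s.ncard := by
  by_cases hx : x ∈ s
  · rw [Set.symmDiff_def, Set.sdiff_eq_empty.2 (Set.singleton_subset_iff.2 hx), Set.union_empty,
      ← Set.ncard_sdiff_singleton_add_one hx hs, Nat.even_add_one, not_not]
  · rw [Set.symmDiff_def, Set.sdiff_singleton_eq_self hx,
      (Set.disjoint_singleton_left.2 hx).sdiff_eq_left, Set.union_singleton,
      Set.ncard_insert_of_notMem hx hs, Nat.even_add_one]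

theorem even_ncard_symmDiff_pair {α : Type*} {s : Set α} {x y : α} (hs : s.Finite) (hxy : x ≠ y) :
    Even (symmDiff s {x, y}).ncard ↔ Even s.ncard := by
  have hpair : symmDiff s {x, y} = symmDiff (symmDiff s {x}) {y} := by
    rw [symmDiff_assoc, (Set.disjoint_singleton.2 hxy).symmDiff_eq_sup]
    rfl
  rw [hpair, even_ncard_symmDiff_singleton (hs.symmDiff (Set.finite_singleton x)),
    even_ncard_symmDiff_singleton hs, not_not]

theorem zero_mem_upMags_iff : 0 ∈ upMags D ↔ (0 : ℤ) ∈ D ∧ Odd (posMags D).ncard := by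
  simp [upMags, zero_notMem_posMags]

-- The sign of `0` follows the parity of the number of positive terms, so that a change of one
-- other sign acts as a change of the sign of `0` as well.
theorem upMags_negate_negate (hD : BddAbove D) {x y : ℤ} (hx : x ∈ D) (hy : y ∈ D)
    (hxM : x.natAbs ∈ singleMags D) (hyM : y.natAbs ∈ singleMags D) (hxy : x.natAbs < y.natAbs) :
    upMags (negate (negate D x) y) = symmDiff (upMags D) {x.natAbs, y.natAbs} := by
  have hcore := sameCore_negate hx hxM
  have hfin := posMags_finite hD
  have hy' : y ∈ negate D x := Or.inr ⟨hy, fun h => hxy.ne' (by rw [h])⟩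
  have hyM' : y.natAbs ∈ singleMags (negate D x) := hcore.singleMags_eq ▸ hyM
  have hzero : 0 ∈ D ↔ 0 ∈ negate (negate D x) y :=
    (hcore.trans (sameCore_negate hy' hyM')).zero_mem_iff
  have hposy := posMags_negate hy' hyM' (by omega)
  ext m
  rcases Nat.eq_zero_or_pos m with rfl | hm
  · rw [Set.mem_symmDiff, zero_mem_upMags_iff, zero_mem_upMags_iff, ← hzero, hposy]
    rcases eq_or_ne x 0 with rfl | hx0
    · rw [negate_zero hx, ← Nat.not_even_iff_odd, ← Nat.not_even_iff_odd,
        even_ncard_symmDiff_singleton hfin]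
      simp [hx]
    · rw [posMags_negate hx hxM hx0, ← Nat.not_even_iff_odd, ← Nat.not_even_iff_odd,
        even_ncard_symmDiff_singleton (hfin.symmDiff (Set.finite_singleton _)),
        even_ncard_symmDiff_singleton hfin]
      simp only [Set.mem_insert_iff, Set.mem_singleton_iff]
      grind
  · rw [Set.mem_symmDiff, mem_upMags_of_pos hm, mem_upMags_of_pos hm, hposy]
    rcases eq_or_ne x 0 with rfl | hx0
    · rw [negate_zero hx]
      simp [Set.mem_symmDiff, hm.ne']
    · rw [posMags_negate hx hxM hx0]
      simp only [Set.mem_symmDiff, Set.mem_insert_iff, Set.mem_singleton_iff]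
      grind

/-- The signs of two consecutive elements `k < l` of `M` change, where `U` and `U'` are the sets of
elements with positive sign before and after the change: `l` becomes positive, and `k` becomes
negative, unless it is the least element of `M`, in which case it can also become positive. -/
structure IsSignChange {α : Type*} [LinearOrder α] (M U U' : Set α) (k l : α) : Prop where
  lt : k < l
  left_mem : k ∈ M
  right_mem : l ∈ M
  le_of_lt : ∀ m ∈ M, k < m → l ≤ m
  notMem : l ∉ U
  mem_or_least : k ∈ U ∨ ∀ m ∈ M, k ≤ m
  eq_symmDiff : U' = symmDiff U {k, l}

theorem isSignChange_image_iff {α β : Type*} [LinearOrder α] [LinearOrder β] {f : α → β}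
    (hf : StrictMono f) {M U U' : Set α} {k l : α} :
    IsSignChange (f '' M) (f '' U) (f '' U') (f k) (f l) ↔ IsSignChange M U U' k l := by
  have hmem : ∀ {s : Set α} {a}, f a ∈ f '' s ↔ a ∈ s := hf.injective.mem_set_image
  have heq : symmDiff (f '' U) {f k, f l} = f '' symmDiff U {k, l} := by
    rw [Set.image_symmDiff hf.injective, Set.image_pair]
  constructor <;> rintro ⟨hlt, hk, hl, hle, hnot, hor, heqU⟩
  · simp only [hmem, hf.lt_iff_lt, hf.le_iff_le, Set.forall_mem_image, heq,
      hf.injective.image_injective.eq_iff] at hlt hk hl hle hnot hor heqU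
    exact ⟨hlt, hk, hl, hle, hnot, hor, heqU⟩
  · constructor <;> simpa only [hmem, hf.lt_iff_lt, hf.le_iff_le, Set.forall_mem_image, heq,
      hf.injective.image_injective.eq_iff]

theorem exists_labelledEdge_iff {a b : Set ℕ+} :
    (∃ l, LabelledEdge l a b) ↔ ∃ m n, IsSignChange Set.univ a b m n := by
  have heq : ∀ {s t : Set ℕ+}, a \ b = s → b \ a = t → b = symmDiff a (s ∪ t) := by
    rintro _ _ rfl rfl
    exact (symmDiff_symmDiff_cancel_left a b).symm
  constructor
  · rintro ⟨α | _, hab, hba⟩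
    · exact ⟨α, α + 1, PNat.lt_add_right α 1, trivial, trivial,
        fun m _ h => PNat.add_one_le_iff.2 h, fun h => (hba.ge rfl).2 h, Or.inl (hab.ge rfl).1,
        heq hab hba⟩
    · refine ⟨1, 2, by decide, trivial, trivial, fun m _ h => PNat.add_one_le_iff.2 h,
        fun h => (hba.ge (by simp)).2 h, Or.inr fun _ _ => one_le, ?_⟩
      rw [heq hab hba, Set.empty_union]
  · rintro ⟨m, n, h⟩
    obtain rfl : n = m + 1 := le_antisymm (h.le_of_lt _ trivial (PNat.lt_add_right m 1))
      (PNat.add_one_le_iff.2 h.lt)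
    have hnot := h.notMem
    by_cases hm : m ∈ a
    · refine ⟨.num m, ?_, ?_⟩ <;> ext i <;>
        simp only [h.eq_symmDiff, Set.mem_sdiff, Set.mem_symmDiff, Set.mem_insert_iff,
          Set.mem_singleton_iff] <;> grind
    · obtain rfl : m = 1 := le_antisymm (h.mem_or_least.resolve_left hm 1 trivial) one_le
      have htwo : (1 + 1 : ℕ+) = 2 := rfl
      rw [htwo] at h hnot
      refine ⟨.oneTwo, ?_, ?_⟩ <;> ext i <;>
        simp only [h.eq_symmDiff, Set.mem_sdiff, Set.mem_symmDiff, Set.mem_insert_iff,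
          Set.mem_singleton_iff, Set.mem_empty_iff_false] <;> grind

namespace IsBalancedMove

variable {x y : ℤ}

theorem eq_negate_negate (h : IsBalancedMove Neg.neg D D' x y) :
    D' = negate (negate D x) (-y) := by
  rw [h.eq_insert, negate, negate, neg_neg]
  ext z
  simp only [Set.mem_insert_iff, Set.mem_sdiff, Set.mem_singleton_iff]
  grind [h.lt, h.reflect_lt]

theorem natAbs_lt (h : IsBalancedMove Neg.neg D D' x y) : x.natAbs < y.natAbs := by
  have := h.lt
  have := h.reflect_lt
  omega

theorem natAbs_left_mem (h : IsBalancedMove Neg.neg D D' x y) : x.natAbs ∈ singleMags D :=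
  (natAbs_mem_singleMags_iff h.mem).2 fun hneg => by linarith [h.reflect_notMem hneg]

theorem natAbs_right_mem (h : IsBalancedMove Neg.neg D D' x y) : y.natAbs ∈ singleMags D := by
  rw [← Int.natAbs_neg, natAbs_mem_singleMags_iff h.reflect_mem, neg_neg]
  exact fun hy => absurd hy h.notMem

theorem notMem_singleMags (h : IsBalancedMove Neg.neg D D' x y) {m : ℕ} (hm : m ≠ x.natAbs)
    (hxm : x < m) (hmy : m < y) : m ∉ singleMags D := by
  rintro ⟨hor, hand⟩
  have hiff := h.reflect_mem_iff m hxm hmy (by omega)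
  have h0 : m = 0 := hand (by tauto) (by tauto)
  subst h0
  exact h.fixed_notMem (by omega) 0 rfl (by simpa using hor)

theorem isSignChange (h : IsBalancedMove Neg.neg D D' x y) (hD : BddAbove D) :
    IsSignChange (singleMags D) (upMags D) (upMags D') x.natAbs y.natAbs where
  lt := h.natAbs_lt
  left_mem := h.natAbs_left_mem
  right_mem := h.natAbs_right_mem
  le_of_lt m hm hxm := by
    by_contra! hmy
    have hlt := h.lt
    have hneg := h.reflect_lt
    exact h.notMem_singleMags hxm.ne' (by omega) (by omega) hm
  notMem := by
    have hlt := h.natAbs_lt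
    rw [mem_upMags_of_pos (by omega)]
    intro hy
    refine h.notMem ?_
    have := h.lt
    have := h.reflect_lt
    convert hy.1
    omega
  mem_or_least := by
    rcases lt_trichotomy x 0 with hx | rfl | hx
    · refine Or.inr fun m hm => ?_
      by_contra! hmx
      have := h.reflect_lt
      exact h.notMem_singleMags hmx.ne (by omega) (by omega) hm
    · exact Or.inr fun m _ => Nat.zero_le m
    · exact Or.inl (Or.inl ((natAbs_mem_posMags_iff h.mem h.natAbs_left_mem).2 hx))
  eq_symmDiff := by
    rw [h.eq_negate_negate, upMags_negate_negate hD h.mem h.reflect_mem h.natAbs_left_mem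
      (by simpa using h.natAbs_right_mem) (by simpa using h.natAbs_lt), Int.natAbs_neg]

theorem sameCore (h : IsBalancedMove Neg.neg D D' x y) : SameCore D D' := by
  have hlt := h.natAbs_lt
  have hcore := sameCore_negate h.mem h.natAbs_left_mem
  rw [h.eq_negate_negate]
  refine hcore.trans (sameCore_negate (Or.inr ⟨h.reflect_mem, ?_⟩) ?_)
  · simp only [Set.mem_singleton_iff]
    omega
  · rw [← hcore.singleMags_eq, Int.natAbs_neg]
    exact h.natAbs_right_mem

end IsBalancedMove

theorem IsSignChange.exists_isBalancedMove {k l : ℕ}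
    (h : IsSignChange (singleMags D) (upMags D) (upMags D') k l) (hD : BddAbove D)
    (hcore : SameCore D D') : ∃ x y, IsBalancedMove Neg.neg D D' x y := by
  have hlt := h.lt
  obtain ⟨x, hx, rfl⟩ := exists_natAbs_eq_of_mem_singleMags h.left_mem
  have hl : (l : ℤ) ∉ D := fun hl => h.notMem <| (mem_upMags_of_pos (by omega)).2
    ⟨hl, fun hneg => by have := h.right_mem.2 hl hneg; omega⟩
  have hnegl : -(l : ℤ) ∈ D := h.right_mem.1.resolve_left hl
  have hleast : x < 0 → ∀ m ∈ singleMags D, x.natAbs ≤ m := fun hneg =>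
    h.mem_or_least.resolve_left fun hup => by
      rw [mem_upMags_of_pos (by omega), natAbs_mem_posMags_iff hx h.left_mem] at hup
      omega
  have hmove : IsBalancedMove Neg.neg D (insert (l : ℤ) (insert (-x) (D \ {x, -(l : ℤ)}))) x l := by
    refine ⟨by omega, by omega, hx, hnegl, hl, fun hneg => ?_, fun hneg z hz hzD => ?_,
      fun z hxz hzl hz => ?_, rfl⟩
    · have := (natAbs_mem_singleMags_iff hx).1 h.left_mem hneg
      omega
    · obtain rfl : z = 0 := by omega
      have := hleast (by omega) 0 (zero_mem_singleMags_iff.2 hzD)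
      omega
    · by_contra hiff
      have hzM : z.natAbs ∈ singleMags D := natAbs_mem_singleMags_of_not_iff hiff
      rcases lt_or_ge x.natAbs z.natAbs with hlt' | hle
      · have := h.le_of_lt _ hzM hlt'
        omega
      · have := hleast (by omega) _ hzM
        omega
  refine ⟨x, l, ?_⟩
  convert hmove using 1
  refine (hcore.symm.trans hmove.sameCore).eq_of_upMags_eq ?_
  rw [h.eq_symmDiff, (hmove.isSignChange hD).eq_symmDiff, Int.natAbs_natCast]

theorem isMinBalancedSkew_iff_dblSet :
    IsMinBalancedSkew δ μ ν ↔
      ∃ x y, IsBalancedMove Neg.neg (dblSet δ μ) (dblSet δ ν) x y := by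
  have hiff : ∀ p q, IsBalancedMove Neg.neg (dblSet δ μ) (dblSet δ ν) (2 * p - δ) (2 * q - δ) ↔
      IsBalancedMove (δ - ·) (beadSet μ) (beadSet ν) p q := fun p q =>
    isBalancedMove_image_iff (strictMono_two_mul_sub δ) neg_involutive fun b => by ring
  rw [isMinBalancedSkew_iff_beadSet]
  constructor
  · rintro ⟨p, q, h⟩
    exact ⟨_, _, (hiff p q).2 h⟩
  · rintro ⟨_, y, h⟩
    obtain ⟨⟨p, -, rfl⟩, ⟨q, -, hq⟩⟩ := And.intro h.mem h.reflect_mem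
    obtain rfl : y = 2 * (δ - q) - δ := by linarith
    exact ⟨_, _, (hiff p _).1 h⟩

theorem exists_isSignChange_iff (hcore : SameCore (dblSet δ μ) (dblSet δ ν)) :
    (∃ k l, IsSignChange (singleMags (dblSet δ μ))
        (upMags (dblSet δ μ)) (upMags (dblSet δ ν)) k l) ↔
      ∃ l, LabelledEdge l (untoggled δ μ) (untoggled δ ν) := by
  have hM := singleMags_infinite δ μ
  have himage : upMags (dblSet δ ν) = place (singleMags (dblSet δ μ)) '' untoggled δ ν := by
    rw [hcore.singleMags_eq, image_place_untoggled]
  have huniv : place (singleMags (dblSet δ μ)) '' Set.univ = singleMags (dblSet δ μ) := by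
    rw [Set.image_univ, range_place hM]
  have hiff := @isSignChange_image_iff _ _ _ _ _ (place_strictMono hM) Set.univ
    (untoggled δ μ) (untoggled δ ν)
  rw [huniv, image_place_untoggled, ← himage] at hiff
  rw [exists_labelledEdge_iff]
  constructor
  · rintro ⟨k, l, h⟩
    obtain ⟨m, rfl⟩ := exists_place_eq hM h.left_mem
    obtain ⟨n, rfl⟩ := exists_place_eq hM h.right_mem
    exact ⟨m, n, hiff.1 h⟩
  · rintro ⟨m, n, h⟩
    exact ⟨_, _, hiff.2 h⟩

theorem isMinBalancedSkew_iff_labelledEdge :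
    IsMinBalancedSkew δ μ ν ↔ SameCore (dblSet δ μ) (dblSet δ ν) ∧
      ∃ l, LabelledEdge l (untoggled δ μ) (untoggled δ ν) := by
  have hD := bddAbove_dblSet δ μ
  rw [isMinBalancedSkew_iff_dblSet]
  constructor
  · rintro ⟨x, y, h⟩
    exact ⟨h.sameCore, (exists_isSignChange_iff h.sameCore).1 ⟨_, _, h.isSignChange hD⟩⟩
  · rintro ⟨hcore, hedge⟩
    obtain ⟨k, l, h⟩ := (exists_isSignChange_iff hcore).2 hedge
    exact h.exists_isBalancedMove hD hcore

end

section

variable {δ : ℤ} {μ ν lam : YoungDiagram}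

theorem eq_of_sameCore_of_untoggled (hcore : SameCore (dblSet δ μ) (dblSet δ ν))
    (h : untoggled δ μ = untoggled δ ν) : μ = ν := by
  refine dblSet_injective δ (hcore.eq_of_upMags_eq ?_)
  rw [← image_place_untoggled, ← image_place_untoggled, hcore.singleMags_eq, h]

theorem exists_dblSet_eq_negate {z : ℤ} (hz : z ∈ dblSet δ μ)
    (hsingle : z.natAbs ∈ singleMags (dblSet δ μ)) :
    ∃ ν, dblSet δ ν = negate (dblSet δ μ) z := by
  rcases eq_or_ne z 0 with rfl | h0
  · exact ⟨μ, (negate_zero hz).symm⟩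
  have hneg : -z ∉ dblSet δ μ := fun hneg => h0 ((natAbs_mem_singleMags_iff hz).1 hsingle hneg)
  obtain ⟨b, hb, rfl⟩ := hz
  have hreflect : 2 * (δ - b) - δ = -(2 * b - δ) := by ring
  obtain ⟨ν, hν⟩ := exists_move μ hb fun hmem : δ - b ∈ beadSet μ =>
    hneg (hreflect ▸ Set.mem_image_of_mem _ hmem)
  refine ⟨ν, ?_⟩
  rw [negate, dblSet, hν, Set.image_insert_eq, hreflect,
    Set.image_sdiff (strictMono_two_mul_sub δ).injective, Set.image_singleton, dblSet]

theorem exists_posMags_eq_symmDiff (T : Finset ℕ)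
    (hT : ∀ k ∈ T, k ∈ singleMags (dblSet δ μ) ∧ 0 < k) :
    ∃ ν, SameCore (dblSet δ μ) (dblSet δ ν) ∧
      posMags (dblSet δ ν) = symmDiff (posMags (dblSet δ μ)) T := by
  induction T using Finset.induction_on with
  | empty => exact ⟨μ, .refl _, by rw [Finset.coe_empty]; exact (symmDiff_bot _).symm⟩
  | insert k T hk ih =>
    obtain ⟨ν, hcore, hpos⟩ := ih fun m hm => hT m (Finset.mem_insert_of_mem hm)
    obtain ⟨hkM, hk0⟩ := hT k (Finset.mem_insert_self k T)
    rw [hcore.singleMags_eq] at hkM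
    obtain ⟨z, hz, rfl⟩ := exists_natAbs_eq_of_mem_singleMags hkM
    obtain ⟨κ, hκ⟩ := exists_dblSet_eq_negate hz hkM
    refine ⟨κ, hcore.trans (hκ ▸ sameCore_negate hz hkM), ?_⟩
    have hinsert : ((insert z.natAbs T : Finset ℕ) : Set ℕ) = symmDiff ↑T {z.natAbs} := by
      rw [Finset.coe_insert, Disjoint.symmDiff_eq_sup (by simpa using hk)]
      exact Set.union_singleton.symm
    rw [hκ, posMags_negate hz hkM (by omega), hpos, symmDiff_assoc, hinsert]

theorem exists_posMags_eq {Q : Set ℕ} (hQ : Q.Finite)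
    (h : ∀ k ∈ Q, k ∈ singleMags (dblSet δ μ) ∧ 0 < k) :
    ∃ ν, SameCore (dblSet δ μ) (dblSet δ ν) ∧ posMags (dblSet δ ν) = Q := by
  have hfin := (posMags_finite (bddAbove_dblSet δ μ)).symmDiff hQ
  obtain ⟨ν, hcore, hν⟩ := exists_posMags_eq_symmDiff (δ := δ) (μ := μ) hfin.toFinset
    fun k hk => by
      rcases hfin.mem_toFinset.1 hk with hk | hk
      · exact ⟨posMags_subset_singleMags hk.1,
          Nat.pos_of_ne_zero fun h0 => zero_notMem_posMags (h0 ▸ hk.1)⟩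
      · exact h k hk.1
  refine ⟨ν, hcore, ?_⟩
  rw [hν, Set.Finite.coe_toFinset, symmDiff_symmDiff_cancel_left]

theorem eq_of_symmDiff_subset_singleton {α : Type*} {a b : Set α} {x : α} (ha : a.Finite)
    (hpar : Even a.ncard ↔ Even b.ncard) (h : symmDiff a b ⊆ {x}) : a = b := by
  rcases Set.subset_singleton_iff_eq.1 h with h | h
  · exact symmDiff_eq_bot.1 h
  · obtain rfl : symmDiff a {x} = b := by rw [← h, symmDiff_symmDiff_cancel_left]
    rw [even_ncard_symmDiff_singleton ha] at hpar
    tauto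

theorem exists_untoggled_eq {a : Set ℕ+} (ha : a.Finite)
    (hpar : Even a.ncard ↔ Even (untoggled δ μ).ncard) :
    ∃ ν, SameCore (dblSet δ μ) (dblSet δ ν) ∧ untoggled δ ν = a := by
  have hM := singleMags_infinite δ μ
  have hmono := place_strictMono hM
  obtain ⟨ν, hcore, hν⟩ := exists_posMags_eq (δ := δ) (μ := μ)
    (Q := place (singleMags (dblSet δ μ)) '' a \ {0})
    (ha.image _).sdiff (by
      rintro _ ⟨⟨n, -, rfl⟩, h⟩
      exact ⟨place_mem hM n, Nat.pos_of_ne_zero h⟩)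
  refine ⟨ν, hcore, ?_⟩
  have hmem_iff : ∀ n, place (singleMags (dblSet δ μ)) n ≠ 0 →
      (n ∈ untoggled δ ν ↔ n ∈ a) := by
    intro n hn
    rw [mem_untoggled_iff, ← hcore.singleMags_eq, mem_upMags_of_pos (Nat.pos_of_ne_zero hn), hν,
      Set.mem_sdiff_singleton, hmono.injective.mem_set_image]
    exact and_iff_left hn
  by_cases h0 : 0 ∈ singleMags (dblSet δ μ)
  · refine eq_of_symmDiff_subset_singleton (x := 1) (untoggled_finite δ ν)
      (iff_of_true (even_ncard_untoggled (hcore.singleMags_eq ▸ h0))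
        (hpar.2 (even_ncard_untoggled h0))) fun n hn => ?_
    by_contra hn1
    have hiff := hmem_iff n ((Nat.zero_le _).trans_lt
      (hmono (lt_of_le_of_ne one_le (Ne.symm hn1)))).ne'
    rw [Set.mem_symmDiff, hiff] at hn
    tauto
  · ext n
    exact hmem_iff n fun h => h0 (h ▸ place_mem hM n)

namespace IsSignChange

variable {α : Type*} [LinearOrder α] {M U U' : Set α} {k l : α}

theorem even_ncard_iff (h : IsSignChange M U U' k l) (hU : U.Finite) :
    Even U.ncard ↔ Even U'.ncard := by
  rw [h.eq_symmDiff, even_ncard_symmDiff_pair hU h.lt.ne]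

theorem ne (h : IsSignChange M U U' k l) : U ≠ U' := by
  rintro rfl
  have hl : l ∈ symmDiff U {k, l} := Or.inr ⟨by simp, h.notMem⟩
  rw [← h.eq_symmDiff] at hl
  exact h.notMem hl

end IsSignChange

theorem exists_isSignChange_of_not_subset {a : Set ℕ+} (ha : ¬ a ⊆ {1}) :
    ∃ a' m n, IsSignChange Set.univ a' a m n := by
  obtain ⟨n, ⟨hna, hn1⟩, hmin⟩ := WellFounded.has_min wellFounded_lt (a \ {1})
    (Set.sdiff_nonempty.2 ha)
  obtain ⟨m, rfl⟩ := PNat.exists_eq_succ_of_ne_one hn1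
  have hlt : m < m + 1 := PNat.lt_add_right m 1
  refine ⟨symmDiff a {m, m + 1}, m, m + 1, hlt, trivial, trivial,
    fun _ _ h => PNat.add_one_le_iff.2 h, ?_, ?_, (symmDiff_symmDiff_cancel_right _ _).symm⟩
  · simp [Set.mem_symmDiff, hna]
  · refine or_iff_not_imp_left.2 fun hm => ?_
    have hma : m ∈ a := by
      by_contra hma
      exact hm (Or.inr ⟨by simp, hma⟩)
    obtain rfl : m = 1 := by
      by_contra hm1
      exact hmin m ⟨hma, hm1⟩ hlt
    exact fun _ _ => one_le

-- A sign pattern with an element other than `1` has a predecessor, which is realized by a smaller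
-- diagram with the same core.
theorem skew_induction (δ : ℤ) {P : YoungDiagram → Prop}
    (base : ∀ μ, untoggled δ μ ⊆ {1} → P μ)
    (step : ∀ μ ν, IsMinBalancedSkew δ μ ν → P μ → P ν) (μ : YoungDiagram) : P μ := by
  induction hn : μ.cells.card using Nat.strong_induction_on generalizing μ with
  | _ n ih =>
    by_cases hsub : untoggled δ μ ⊆ {1}
    · exact base μ hsub
    obtain ⟨a, k, l, h⟩ := exists_isSignChange_of_not_subset hsub
    have ha : a.Finite := by
      rw [← symmDiff_symmDiff_cancel_right {k, l} a, ← h.eq_symmDiff]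
      exact (untoggled_finite δ μ).symmDiff (Set.toFinite _)
    obtain ⟨ν, hcore, rfl⟩ := exists_untoggled_eq (δ := δ) (μ := μ) ha (h.even_ncard_iff ha)
    have hskew : IsMinBalancedSkew δ ν μ :=
      isMinBalancedSkew_iff_labelledEdge.2 ⟨hcore.symm, exists_labelledEdge_iff.2 ⟨k, l, h⟩⟩
    have hne : ν.cells ≠ μ.cells := fun heq => h.ne (by rw [YoungDiagram.ext heq])
    exact step ν μ hskew
      (ih _ (hn ▸ Finset.card_lt_card (Finset.ssubset_iff_subset_ne.2 ⟨hskew.1, hne⟩)) ν rfl)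

theorem IsMinBalancedSkew.eqvGen (h : IsMinBalancedSkew δ μ ν) :
    Relation.EqvGen (ltDelta δ) μ ν := .rel _ _ (.single h)

theorem exists_eqvGen_untoggled_subset (δ : ℤ) (μ : YoungDiagram) :
    ∃ ν, Relation.EqvGen (ltDelta δ) μ ν ∧ untoggled δ ν ⊆ {1} := by
  induction μ using skew_induction δ with
  | base μ h => exact ⟨μ, .refl _, h⟩
  | step μ κ hskew ih =>
    obtain ⟨ν, hν, hsub⟩ := ih
    exact ⟨ν, .trans _ _ _ (.symm _ _ hskew.eqvGen) hν, hsub⟩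

theorem IsMinBalancedSkew.sameCore_and_even_iff (h : IsMinBalancedSkew δ μ ν) :
    SameCore (dblSet δ μ) (dblSet δ ν) ∧
      (Even (untoggled δ μ).ncard ↔ Even (untoggled δ ν).ncard) := by
  obtain ⟨hcore, hedge⟩ := isMinBalancedSkew_iff_labelledEdge.1 h
  obtain ⟨m, n, hchange⟩ := exists_labelledEdge_iff.1 hedge
  exact ⟨hcore, hchange.even_ncard_iff (untoggled_finite δ μ)⟩

theorem sameCore_and_even_iff_of_eqvGen (h : Relation.EqvGen (ltDelta δ) μ ν) :
    SameCore (dblSet δ μ) (dblSet δ ν) ∧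
      (Even (untoggled δ μ).ncard ↔ Even (untoggled δ ν).ncard) := by
  induction h with
  | rel μ ν h =>
    induction h with
    | single h => exact h.sameCore_and_even_iff
    | tail _ h ih =>
      exact ⟨ih.1.trans h.sameCore_and_even_iff.1, ih.2.trans h.sameCore_and_even_iff.2⟩
  | refl μ => exact ⟨.refl _, Iff.rfl⟩
  | symm μ ν _ ih => exact ⟨ih.1.symm, ih.2.symm⟩
  | trans μ ν κ _ _ ih ih' => exact ⟨ih.1.trans ih'.1, ih.2.trans ih'.2⟩

theorem mem_block_iff :
    μ ∈ block δ lam ↔ SameCore (dblSet δ lam) (dblSet δ μ) ∧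
      (Even (untoggled δ lam).ncard ↔ Even (untoggled δ μ).ncard) := by
  refine ⟨sameCore_and_even_iff_of_eqvGen, ?_⟩
  rintro ⟨hcore, hpar⟩
  obtain ⟨lam₀, hlam, hlam₀⟩ := exists_eqvGen_untoggled_subset δ lam
  obtain ⟨μ₀, hμ, hμ₀⟩ := exists_eqvGen_untoggled_subset δ μ
  obtain ⟨hcore_lam, hpar_lam⟩ := sameCore_and_even_iff_of_eqvGen hlam
  obtain ⟨hcore_mu, hpar_mu⟩ := sameCore_and_even_iff_of_eqvGen hμ
  have huntoggled : untoggled δ lam₀ = untoggled δ μ₀ :=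
    eq_of_symmDiff_subset_singleton (untoggled_finite δ lam₀)
      (hpar_lam.symm.trans (hpar.trans hpar_mu))
      (symmDiff_le_sup.trans (Set.union_subset hlam₀ hμ₀))
  obtain rfl : lam₀ = μ₀ :=
    eq_of_sameCore_of_untoggled ((hcore_lam.symm.trans hcore).trans hcore_mu) huntoggled
  exact .trans _ _ _ hlam (.symm _ _ hμ)

theorem toggle_toggle (a : Set ℕ+) : toggle (toggle a) = a :=
  symmDiff_symmDiff_cancel_right {1} a

theorem toggle_finite {a : Set ℕ+} (ha : a.Finite) : (toggle a).Finite :=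
  ha.symmDiff (Set.finite_singleton 1)

theorem IsSignChange.toggle {a b : Set ℕ+} {m n : ℕ+} (h : IsSignChange Set.univ a b m n) :
    IsSignChange Set.univ (toggle a) (toggle b) m n where
  lt := h.lt
  left_mem := trivial
  right_mem := trivial
  le_of_lt := h.le_of_lt
  notMem := by
    have hn : n ≠ 1 := (one_le.trans_lt h.lt).ne'
    simp [BrauerBlock.toggle, Set.mem_symmDiff, h.notMem, hn]
  mem_or_least := by
    rcases eq_or_ne m 1 with rfl | hm
    · exact Or.inr fun _ _ => one_le
    · exact h.mem_or_least.imp_left fun hma => Or.inl ⟨hma, hm⟩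
  eq_symmDiff := by
    rw [BrauerBlock.toggle, BrauerBlock.toggle, h.eq_symmDiff, symmDiff_right_comm]

theorem exists_labelledEdge_toggle_iff {a b : Set ℕ+} :
    (∃ l, LabelledEdge l (toggle a) (toggle b)) ↔ ∃ l, LabelledEdge l a b := by
  simp only [exists_labelledEdge_iff]
  constructor <;> rintro ⟨m, n, h⟩
  · exact ⟨m, n, by simpa only [toggle_toggle] using h.toggle⟩
  · exact ⟨m, n, h.toggle⟩

/-- The toggle map as an isomorphism from `G_odd` to `G_even`. -/
noncomputable def toggleIso : DigraphIso graphOdd graphEven where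
  toFun a := ⟨toggle a, toggle_finite a.2.1,
    (even_ncard_symmDiff_singleton a.2.1 1).2 (Nat.not_even_iff_odd.2 a.2.2)⟩
  invFun a := ⟨toggle a, toggle_finite a.2.1,
    Nat.not_even_iff_odd.1 fun h => (even_ncard_symmDiff_singleton a.2.1 1).1 h a.2.2⟩
  left_inv _ := Subtype.ext (toggle_toggle _)
  right_inv _ := Subtype.ext (toggle_toggle _)
  map_rel_iff' := exists_labelledEdge_toggle_iff

theorem sameCore_of_mem_block (hμ : μ ∈ block δ lam) (hν : ν ∈ block δ lam) :
    SameCore (dblSet δ μ) (dblSet δ ν) :=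
  (mem_block_iff.1 hμ).1.symm.trans (mem_block_iff.1 hν).1

theorem untoggled_bijOn (δ : ℤ) (lam : YoungDiagram) :
    Set.BijOn (untoggled δ) (block δ lam)
      {a | a.Finite ∧ (Even (untoggled δ lam).ncard ↔ Even a.ncard)} := by
  refine ⟨fun μ hμ => ⟨untoggled_finite δ μ, (mem_block_iff.1 hμ).2⟩, fun μ hμ ν hν h =>
    eq_of_sameCore_of_untoggled (sameCore_of_mem_block hμ hν) h, ?_⟩
  rintro a ⟨ha, hpar⟩
  obtain ⟨ν, hcore, rfl⟩ := exists_untoggled_eq (δ := δ) (μ := lam) ha hpar.symm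
  exact ⟨ν, mem_block_iff.2 ⟨hcore, hpar⟩, rfl⟩

theorem adj_blockGraph_iff (μ ν : block δ lam) :
    (blockGraph δ lam).Adj μ ν ↔ ∃ l, LabelledEdge l (untoggled δ μ) (untoggled δ ν) :=
  isMinBalancedSkew_iff_labelledEdge.trans (and_iff_right (sameCore_of_mem_block μ.2 ν.2))

theorem exists_iso_graphEven (h : Even (untoggled δ lam).ncard) :
    ∃ Φ : DigraphIso (blockGraph δ lam) graphEven, ∀ ν, (Φ ν : Set ℕ+) = untoggled δ ν := by
  have hbij := untoggled_bijOn δ lam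
  simp only [h, true_iff] at hbij
  exact ⟨⟨hbij.equiv, (adj_blockGraph_iff _ _).symm⟩, fun _ => rfl⟩

theorem exists_iso_graphOdd (h : Odd (untoggled δ lam).ncard) :
    ∃ Φ : DigraphIso (blockGraph δ lam) graphOdd, ∀ ν, (Φ ν : Set ℕ+) = untoggled δ ν := by
  have hbij := untoggled_bijOn δ lam
  simp only [Nat.not_even_iff_odd.2 h, false_iff, Nat.not_even_iff_odd] at hbij
  exact ⟨⟨hbij.equiv, (adj_blockGraph_iff _ _).symm⟩, fun _ => rfl⟩

theorem exists_iso_oMap (δ : ℤ) (lam : YoungDiagram) :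
    ∃ Φ : DigraphIso (blockGraph δ lam) graphEven,
      (∀ ν, (Φ ν : Set ℕ+) = oMap δ ν) ∧
      (Even (untoggled δ lam).ncard → ∀ ν, (Φ ν : Set ℕ+) = untoggled δ ν) ∧
      (Odd (untoggled δ lam).ncard →
        ∃ Φ' : DigraphIso (blockGraph δ lam) graphOdd,
          (∀ ν, (Φ' ν : Set ℕ+) = untoggled δ ν) ∧ ∀ ν, Φ ν = toggleIso (Φ' ν)) := by
  have hpar : ∀ ν : block δ lam,
      (Odd (untoggled δ ν).ncard ↔ Odd (untoggled δ lam).ncard) := fun ν => by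
    rw [← Nat.not_even_iff_odd, ← Nat.not_even_iff_odd, (mem_block_iff.1 ν.2).2]
  by_cases heven : Even (untoggled δ lam).ncard
  · have hodd := Nat.not_odd_iff_even.2 heven
    obtain ⟨Φ, hΦ⟩ := exists_iso_graphEven heven
    refine ⟨Φ, fun ν => ?_, fun _ => hΦ, fun h => absurd h hodd⟩
    rw [hΦ, oMap, if_neg ((hpar ν).not.2 hodd)]
  · have hodd := Nat.not_even_iff_odd.1 heven
    obtain ⟨Φ', hΦ'⟩ := exists_iso_graphOdd hodd
    refine ⟨Φ'.trans toggleIso, fun ν => ?_, fun h => absurd h heven,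
      fun _ => ⟨Φ', hΦ', fun _ => rfl⟩⟩
    rw [oMap, if_pos ((hpar ν).2 hodd), ← hΦ']
    rfl

theorem oMap_bijOn (δ : ℤ) (lam : YoungDiagram) :
    Set.BijOn (oMap δ) (block δ lam) evenSubsets := by
  obtain ⟨Φ, hΦ, -⟩ := exists_iso_oMap δ lam
  refine ⟨fun ν hν => ?_, fun μ hμ ν hν h => ?_, fun a ha => ?_⟩
  · rw [← hΦ ⟨ν, hν⟩]
    exact (Φ _).2
  · have heq : Φ ⟨μ, hμ⟩ = Φ ⟨ν, hν⟩ := Subtype.ext (by rw [hΦ, hΦ]; exact h)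
    exact congrArg Subtype.val (Φ.injective heq)
  · refine ⟨Φ.symm ⟨a, ha⟩, (Φ.symm ⟨a, ha⟩).2, ?_⟩
    rw [← hΦ, RelIso.apply_symm_apply]

end

section

/-! ### Signed sequences -/

/-- `s` enumerates, each exactly once, the integers `n ∈ a` and `-n`, `n ∉ a`, where `n > 0`. -/
structure IsSignedEnum (a : Set ℕ+) (s : ℕ → ℤ) : Prop where
  injective : Function.Injective s
  neg_mem_range_iff : ∀ z, -z ∈ Set.range s ↔ z ∉ Set.range s ∧ z ≠ 0
  mem_iff : ∀ n : ℕ+, n ∈ a ↔ (n : ℤ) ∈ Set.range s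

/-- `s` is the descending arrangement of the integers `n ∈ a` and `-n`, `n ∉ a`, where `n > 0`. -/
structure IsSignedSeq (a : Set ℕ+) (s : ℕ → ℤ) : Prop extends IsSignedEnum a s where
  strictAnti : StrictAnti s

/-- The pairs `i < j` of positions with `s i + s j > 0`. -/
def posPairs (s : ℕ → ℤ) : Set (ℕ × ℕ) := {q | q.1 < q.2 ∧ 0 < s q.1 + s q.2}

/-- The reflection `(ij)_-` on integer sequences: it exchanges the entries `s i` and `s j` and
changes the sign of both. -/
def reflect (i j : ℕ) (s : ℕ → ℤ) : ℕ → ℤ :=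
  fun k => if k = i ∨ k = j then -s (Equiv.swap i j k) else s k

variable {a b : Set ℕ+} {s t : ℕ → ℤ} {i j : ℕ}

theorem reflect_left : reflect i j s i = -s j := by
  simp [reflect]

theorem reflect_right : reflect i j s j = -s i := by
  simp [reflect]

theorem reflect_of_ne {k : ℕ} (hi : k ≠ i) (hj : k ≠ j) : reflect i j s k = s k := by
  simp [reflect, hi, hj]

theorem strictAnti_reflect (hs : StrictAnti s) (hij : i < j) (hsum : s i + s j < 0)
    (hgap : ∀ k, k ≠ i → k ≠ j → (s i < s k ↔ -s j < s k) ∧ (s j < s k ↔ -s i < s k)) :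
    StrictAnti (reflect i j s) := by
  intro k l hkl
  have := hs hij
  have := hs hkl
  grind [reflect_left, reflect_right, reflect_of_ne]

theorem posPairs_reflect (hs : StrictAnti s) (hij : i < j) (hsum : s i + s j < 0)
    (hgap : ∀ k, k ≠ i → k ≠ j → (s i < s k ↔ -s j < s k) ∧ (s j < s k ↔ -s i < s k)) :
    posPairs (reflect i j s) = insert (i, j) (posPairs s) := by
  ext ⟨k, l⟩
  simp only [posPairs, Set.mem_ofPred_eq, Set.mem_insert_iff, Prod.mk.injEq]
  rcases lt_or_ge k l with hkl | hkl
  · have := hs hij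
    have := hs hkl
    grind [reflect_left, reflect_right, reflect_of_ne]
  · omega

theorem le_sub_of_strictAnti (hs : StrictAnti s) (k : ℕ) : s k ≤ s 0 - k := by
  induction k with
  | zero => simp
  | succ k ih =>
    have := hs (Nat.lt_add_one k)
    push_cast
    omega

theorem posPairs_finite (hs : StrictAnti s) : (posPairs s).Finite := by
  refine ((Set.finite_Iic (2 * s 0).toNat).prod (Set.finite_Iic (2 * s 0).toNat)).subset ?_
  rintro ⟨i, j⟩ ⟨-, hsum⟩
  have := le_sub_of_strictAnti hs i
  have := le_sub_of_strictAnti hs j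
  simp only [Set.mem_prod, Set.mem_Iic] at *
  omega

theorem isSignedSeq_empty : IsSignedSeq ∅ fun i => -((i : ℤ) + 1) := by
  have hrange (z : ℤ) : z ∈ Set.range (fun i : ℕ => -((i : ℤ) + 1)) ↔ z < 0 :=
    ⟨by rintro ⟨i, rfl⟩; simp only; omega, fun hz => ⟨(-z - 1).toNat, by simp only; omega⟩⟩
  refine ⟨⟨fun i j hij => by simpa using hij, fun z => ?_, fun n => ?_⟩,
    fun i j hij => by omega⟩
  · rw [hrange, hrange]
    omega
  · have := n.pos
    rw [hrange]
    simp only [Set.mem_empty_iff_false, false_iff]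
    omega

theorem natAbs_reflect (k : ℕ) : (reflect i j s k).natAbs = (s (Equiv.swap i j k)).natAbs := by
  by_cases h : k = i ∨ k = j
  · simp [reflect, h]
  · rw [not_or] at h
    rw [reflect_of_ne h.1 h.2, Equiv.swap_apply_of_ne_of_ne h.1 h.2]

namespace IsSignedEnum

theorem ne_zero (hs : IsSignedEnum a s) (i : ℕ) : s i ≠ 0 := fun h =>
  ((hs.neg_mem_range_iff 0).1 ⟨i, by rw [h, neg_zero]⟩).2 rfl

theorem add_ne_zero (hs : IsSignedEnum a s) (i j : ℕ) : s i + s j ≠ 0 := fun h =>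
  ((hs.neg_mem_range_iff (s j)).1 ⟨i, eq_neg_of_add_eq_zero_left h⟩).1 ⟨j, rfl⟩

theorem exists_natAbs_eq (hs : IsSignedEnum a s) {n : ℕ} (hn : 0 < n) : ∃ i, (s i).natAbs = n := by
  by_cases hmem : (n : ℤ) ∈ Set.range s
  · obtain ⟨i, hi⟩ := hmem
    exact ⟨i, by omega⟩
  · obtain ⟨i, hi⟩ := (hs.neg_mem_range_iff n).2 ⟨hmem, by omega⟩
    exact ⟨i, by omega⟩

theorem natAbs_injective (hs : IsSignedEnum a s) :
    Function.Injective fun i => (s i).natAbs := fun i j h =>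
  (Int.natAbs_eq_natAbs_iff.1 h).elim (hs.injective ·)
    fun h => absurd (by omega) (hs.add_ne_zero i j)

theorem mem_range_iff (hs : IsSignedEnum a s) {z : ℤ} (hz : z ≠ 0) :
    z ∈ Set.range s ↔ (z.natAbs : ℤ) ∈ Set.range s ∧ 0 < z ∨
      (z.natAbs : ℤ) ∉ Set.range s ∧ z < 0 := by
  have := hs.neg_mem_range_iff (-z)
  rcases lt_or_gt_of_ne hz with hneg | hpos
  · rw [Int.ofNat_natAbs_of_nonpos hneg.le]
    grind
  · rw [Int.natAbs_of_nonneg hpos.le]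
    grind

theorem range_eq (hs : IsSignedEnum a s) (ht : IsSignedEnum a t) : Set.range s = Set.range t := by
  ext z
  rcases eq_or_ne z 0 with rfl | hz
  · exact iff_of_false (fun ⟨i, hi⟩ => hs.ne_zero i hi) fun ⟨i, hi⟩ => ht.ne_zero i hi
  · have habs := (hs.mem_iff ⟨z.natAbs, by omega⟩).symm.trans (ht.mem_iff _)
    simp only [PNat.mk_coe] at habs
    rw [hs.mem_range_iff hz, ht.mem_range_iff hz, habs]

theorem comp_equiv (hs : IsSignedEnum a s) (e : ℕ ≃ ℕ) : IsSignedEnum a (s ∘ e) := by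
  have hrange : Set.range (s ∘ e) = Set.range s := e.surjective.range_comp s
  exact ⟨hs.injective.comp e.injective, hrange ▸ hs.neg_mem_range_iff, hrange ▸ hs.mem_iff⟩

theorem mem_range_reflect_iff (hs : IsSignedEnum a s) (hij : i ≠ j) {z : ℤ} :
    z ∈ Set.range (reflect i j s) ↔
      if z.natAbs = (s i).natAbs ∨ z.natAbs = (s j).natAbs then -z ∈ Set.range s
      else z ∈ Set.range s := by
  have habs (k l : ℕ) (h : (s k).natAbs = (s l).natAbs) : k = l := hs.natAbs_injective h
  have hleft : reflect i j s i = -s j := reflect_left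
  have hright : reflect i j s j = -s i := reflect_right
  have hne (k : ℕ) (hki : k ≠ i) (hkj : k ≠ j) : reflect i j s k = s k := reflect_of_ne hki hkj
  constructor
  · rintro ⟨k, rfl⟩
    grind
  · split_ifs with hz
    · rintro ⟨k, hk⟩
      rcases hz with hz | hz
      · obtain rfl := habs k i (by omega)
        exact ⟨j, by omega⟩
      · obtain rfl := habs k j (by omega)
        exact ⟨i, by omega⟩
    · rintro ⟨k, rfl⟩
      exact ⟨k, hne k (by rintro rfl; simp at hz) (by rintro rfl; simp at hz)⟩

theorem symmDiff_reflect (hs : IsSignedEnum a s) (hij : i ≠ j) {m n : ℕ+} (hi : (s i).natAbs = m)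
    (hj : (s j).natAbs = n) : IsSignedEnum (symmDiff a {m, n}) (reflect i j s) := by
  refine ⟨fun k l hkl => (Equiv.swap i j).injective (hs.natAbs_injective ?_), fun z => ?_,
    fun x => ?_⟩
  · simp only [← natAbs_reflect, hkl]
  · rw [hs.mem_range_reflect_iff hij, hs.mem_range_reflect_iff hij, Int.natAbs_neg]
    have := hs.neg_mem_range_iff z
    have := hs.neg_mem_range_iff (-z)
    grind
  · have hneg := hs.neg_mem_range_iff x
    have := x.pos
    simp only [hs.mem_range_reflect_iff hij, Int.natAbs_natCast, hi, hj, PNat.coe_inj,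
      Set.mem_symmDiff, Set.mem_insert_iff, Set.mem_singleton_iff, hs.mem_iff, hneg]
    grind

theorem exists_entries_of_isSignChange (hs : IsSignedEnum a s) {m n : ℕ+}
    (h : IsSignChange Set.univ a b m n) :
    ∃ i j, (s i = m ∨ s i = -1 ∧ m = 1) ∧ s j = -(m + 1) ∧ n = m + 1 := by
  obtain rfl : n = m + 1 :=
    le_antisymm (h.le_of_lt _ trivial (PNat.lt_add_right m 1)) (PNat.add_one_le_iff.2 h.lt)
  have hneg (k : ℕ+) (hk : k ∉ a) : ∃ i, s i = -k :=
    (hs.neg_mem_range_iff k).2 ⟨mt (hs.mem_iff k).2 hk, by have := k.pos; omega⟩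
  obtain ⟨j, hj⟩ := hneg _ h.notMem
  suffices hi : ∃ i, s i = m ∨ s i = -1 ∧ m = 1 by
    obtain ⟨i, hi⟩ := hi
    exact ⟨i, j, hi, by simpa using hj, rfl⟩
  by_cases hm : m ∈ a
  · obtain ⟨i, hi⟩ := (hs.mem_iff m).1 hm
    exact ⟨i, Or.inl hi⟩
  · obtain rfl : m = 1 :=
      le_antisymm (h.mem_or_least.resolve_left hm 1 trivial) one_le
    obtain ⟨i, hi⟩ := hneg 1 hm
    exact ⟨i, Or.inr ⟨hi, rfl⟩⟩

end IsSignedEnum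

namespace IsSignedSeq

theorem unique (hs : IsSignedSeq a s) (ht : IsSignedSeq a t) : s = t :=
  (StrictMono.range_inj (f := OrderDual.toDual ∘ s) (g := OrderDual.toDual ∘ t)
    hs.strictAnti ht.strictAnti).1 (hs.range_eq ht.toIsSignedEnum)

theorem exists_reflection (hs : IsSignedSeq a s) (ht : IsSignedSeq b t)
    (h : ∃ l, LabelledEdge l a b) :
    ∃ i j, i < j ∧ t = reflect i j s ∧ (i, j) ∉ posPairs s ∧
      posPairs t = insert (i, j) (posPairs s) := by
  obtain ⟨m, n, hmn⟩ := exists_labelledEdge_iff.1 h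
  obtain ⟨i, j, hi, hj, rfl⟩ := hs.exists_entries_of_isSignChange hmn
  have hm := m.pos
  have hi_abs : (s i).natAbs = m := by
    rcases hi with hi | ⟨hi, rfl⟩
    · omega
    · simp [hi]
  have hj_abs : (s j).natAbs = (m + 1 : ℕ+) := by
    rw [PNat.add_coe, PNat.one_coe]
    omega
  have hi_cases : s i = m ∨ s i = -m ∧ (m : ℕ) = 1 := by
    rcases hi with hi | ⟨hi, rfl⟩
    · exact Or.inl hi
    · simp [hi]
  have hij : i < j := by
    rw [← hs.strictAnti.lt_iff_gt]
    omega
  have hgap (k : ℕ) (hki : k ≠ i) (hkj : k ≠ j) :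
      (s i < s k ↔ -s j < s k) ∧ (s j < s k ↔ -s i < s k) := by
    have := hs.natAbs_injective.ne hki
    have := hs.natAbs_injective.ne hkj
    have := hs.ne_zero k
    omega
  have hanti := strictAnti_reflect hs.strictAnti hij (by omega) hgap
  obtain rfl : reflect i j s = t :=
    IsSignedSeq.unique ⟨hs.symmDiff_reflect hij.ne hi_abs hj_abs, hanti⟩ (hmn.eq_symmDiff ▸ ht)
  exact ⟨i, j, hij, rfl, fun hmem => by have := hmem.2; simp only at this; omega,
    posPairs_reflect hs.strictAnti hij (by omega) hgap⟩

theorem ncard_row (hs : IsSignedSeq a s) (i : ℕ) :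
    {j | (i, j) ∈ posPairs s}.ncard = (s i - 1).toNat := by
  rw [← Set.ncard_image_of_injective _ hs.natAbs_injective,
    show (s i - 1).toNat = (Set.Ico 1 (s i).toNat).ncard by
      simp [Set.ncard_eq_toFinset_card']]
  congr 1
  ext n
  simp only [posPairs, Set.mem_image, Set.mem_ofPred_eq, Set.mem_Ico]
  constructor
  · rintro ⟨j, ⟨hij, hsum⟩, rfl⟩
    have := hs.strictAnti hij
    have := hs.ne_zero j
    omega
  · rintro ⟨hpos, hlt⟩
    obtain ⟨j, rfl⟩ := hs.exists_natAbs_eq hpos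
    refine ⟨j, ⟨?_, by omega⟩, rfl⟩
    rw [← hs.strictAnti.lt_iff_gt]
    omega

end IsSignedSeq

theorem eq_of_posPairs_eq (hs : IsSignedSeq a s) (ht : IsSignedSeq b t) (ha : a ∈ evenSubsets)
    (hb : b ∈ evenSubsets) (h : posPairs s = posPairs t) : a = b := by
  refine eq_of_symmDiff_subset_singleton ha.1 (iff_of_true ha.2 hb.2) (x := 1) fun n hn => ?_
  by_contra hne
  have hrow (i : ℕ) : (s i - 1).toNat = (t i - 1).toNat := by
    rw [← hs.ncard_row, ← ht.ncard_row, h]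
  have hn_coe : (n : ℕ) ≠ 1 := mt PNat.coe_eq_one_iff.1 hne
  have hn_pos := n.pos
  have hiff : n ∈ a ↔ n ∈ b := by
    rw [hs.mem_iff, ht.mem_iff]
    refine exists_congr fun i => ?_
    have := hrow i
    omega
  rw [Set.mem_symmDiff] at hn
  tauto

theorem mem_iff_mem_symmDiff_of_rows (hs : IsSignedSeq a s) (ht : IsSignedSeq b t) {m n : ℕ+}
    (hsi : (m : ℤ) = max (s i) 1) (hti : t i = (m + 1 : ℕ+))
    (hrow : ∀ k, k ≠ i → (t k - 1).toNat = (s k - 1).toNat) (hn : n ≠ 1) :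
    n ∈ b ↔ n ∈ symmDiff a {m, m + 1} := by
  have hn_coe : (n : ℕ) ≠ 1 := mt PNat.coe_eq_one_iff.1 hn
  have hn_pos := n.pos
  push_cast at hti
  have hm_iff : n = m ↔ (n : ℤ) = m := by norm_cast
  have hsucc_iff : n = m + 1 ↔ (n : ℤ) = m + 1 := by norm_cast
  have hother (k : ℕ) (hk : k ≠ i) : s k = n ↔ t k = n := by
    have := hrow k hk
    omega
  have hs_inj (k : ℕ) : s k = s i → k = i := (hs.strictAnti.injective ·)
  have ht_inj (k : ℕ) : t k = t i → k = i := (ht.strictAnti.injective ·)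
  rw [Set.mem_symmDiff, hs.mem_iff, ht.mem_iff, Set.mem_insert_iff, Set.mem_singleton_iff, hm_iff,
    hsucc_iff]
  constructor
  · rintro ⟨k, hk⟩
    grind
  · rintro (⟨⟨k, hk⟩, hne⟩ | ⟨heq | heq, hnot⟩)
    · exact ⟨k, (hother k (by rintro rfl; omega)).1 hk⟩
    · exact absurd ⟨i, by omega⟩ hnot
    · exact ⟨i, hti.trans heq.symm⟩

/-- The number of pairs in each row determines all entries `≥ 2`, and parity then determines whether
`1` is an entry. -/
theorem labelledEdge_of_posPairs_insert (hs : IsSignedSeq a s) (ht : IsSignedSeq b t)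
    (ha : a ∈ evenSubsets) (hb : b ∈ evenSubsets) (hij : (i, j) ∉ posPairs s)
    (h : posPairs t = insert (i, j) (posPairs s)) : ∃ l, LabelledEdge l a b := by
  have hrow (k : ℕ) (hk : k ≠ i) : (t k - 1).toNat = (s k - 1).toNat := by
    rw [← hs.ncard_row, ← ht.ncard_row, h]
    simp [hk]
  have hrow_i : (t i - 1).toNat = (s i - 1).toNat + 1 := by
    have hfin : {l | (i, l) ∈ posPairs s}.Finite :=
      (posPairs_finite hs.strictAnti).preimage (Prod.mk_right_injective i).injOn
    rw [← hs.ncard_row, ← ht.ncard_row, h,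
      ← Set.ncard_insert_of_notMem (s := {l | (i, l) ∈ posPairs s}) hij hfin]
    simp [Set.insert_def]
  obtain ⟨m, hm⟩ : ∃ m : ℕ+, (m : ℤ) = max (s i) 1 := CanLift.prf _ (by omega)
  have hti : t i = (m + 1 : ℕ+) := by
    push_cast
    omega
  have hnot : m + 1 ∉ a := fun hmem => by
    obtain ⟨k, hk⟩ := (hs.mem_iff _).1 hmem
    push_cast at hk
    have hki : k ≠ i := by
      rintro rfl
      omega
    have := hrow k hki
    exact hki (ht.strictAnti.injective (by push_cast at hti; omega))
  have hchange : IsSignChange Set.univ a (symmDiff a {m, m + 1}) m (m + 1) := by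
    refine ⟨PNat.lt_add_right m 1, trivial, trivial, fun _ _ => PNat.add_one_le_iff.2, hnot, ?_,
      rfl⟩
    rcases eq_or_ne (m : ℤ) (s i) with hm_eq | hm_ne
    · exact Or.inl ((hs.mem_iff m).2 ⟨i, hm_eq.symm⟩)
    · obtain rfl : m = 1 := PNat.coe_eq_one_iff.1 (by omega)
      exact Or.inr fun _ _ => one_le
  suffices b = symmDiff a {m, m + 1} from this ▸ exists_labelledEdge_iff.2 ⟨m, m + 1, hchange⟩
  refine eq_of_symmDiff_subset_singleton (x := 1) hb.1
    (iff_of_true hb.2 ((hchange.even_ncard_iff ha.1).1 ha.2)) fun n hn => ?_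
  by_contra hne
  have hiff := mem_iff_mem_symmDiff_of_rows hs ht hm hti hrow hne
  rw [Set.mem_symmDiff] at hn
  tauto

end

section

/-! ### Alcoves as sign chambers -/

/-- The complement of all reflection hyperplanes. -/
def regularPoints : Set (ℕ → ℝ) := (⋃₀ hyperplanes)ᶜ

/-- The descending sequences `y` for which the hyperplanes `y i + y j = 0`, `i < j`, with `y` on
their positive side are those indexed by the pairs in `P`. -/
def chamber (P : Set (ℕ × ℕ)) : Set (ℕ → ℝ) :=
  {y | StrictAnti y ∧
    ∀ i j, i < j → ((i, j) ∈ P → 0 < y i + y j) ∧ ((i, j) ∉ P → y i + y j < 0)}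

variable {P Q : Set (ℕ × ℕ)} {i j : ℕ} {x y : ℕ → ℝ}

theorem mem_regularPoints_iff :
    x ∈ regularPoints ↔ ∀ i j, i < j → x i ≠ x j ∧ x i ≠ -x j := by
  constructor
  · refine fun h i j hij => ⟨fun heq => h ?_, fun heq => h ?_⟩
    · exact ⟨{v | v i = v j}, ⟨i, j, hij, Or.inl rfl⟩, heq⟩
    · exact ⟨{v | v i = -v j}, ⟨i, j, hij, Or.inr rfl⟩, heq⟩
  · rintro h ⟨H, ⟨i, j, hij, rfl | rfl⟩, hx⟩
    · exact (h i j hij).1 hx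
    · exact (h i j hij).2 hx

theorem mem_regularPoints_iff_abs :
    x ∈ regularPoints ↔ Function.Injective fun i => |x i| := by
  simp only [mem_regularPoints_iff, ← not_or, ← abs_eq_abs]
  refine ⟨fun h i j heq => ?_, fun h i j hij => h.ne hij.ne⟩
  by_contra hne
  exact (lt_or_gt_of_ne hne).elim (fun hlt => h i j hlt heq) fun hlt => h j i hlt heq.symm

theorem mem_iff_pos_of_mem_chamber (hy : y ∈ chamber P) (hij : i < j) :
    (i, j) ∈ P ↔ 0 < y i + y j :=
  ⟨(hy.2 i j hij).1, fun hpos => by_contra fun hP => hpos.not_gt ((hy.2 i j hij).2 hP)⟩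

theorem chamber_subset_regularPoints : chamber P ⊆ regularPoints := by
  refine fun y hy => mem_regularPoints_iff.2 fun i j hij => ⟨(hy.1 hij).ne', fun heq => ?_⟩
  obtain ⟨hpos, hneg⟩ := hy.2 i j hij
  have hzero : y i + y j = 0 := by rw [heq, neg_add_cancel]
  by_cases hP : (i, j) ∈ P
  · exact (hpos hP).ne' hzero
  · exact (hneg hP).ne hzero

theorem convex_setOf_lt (i j : ℕ) : Convex ℝ {v : ℕ → ℝ | v j < v i} := by
  have hlinear : IsLinearMap ℝ fun v : ℕ → ℝ => v i - v j :=
    ⟨fun v w => add_sub_add_comm (v i) (w i) (v j) (w j), fun c v => (mul_sub c (v i) (v j)).symm⟩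
  simpa only [sub_pos] using convex_halfSpace_gt hlinear 0

theorem isLinearMap_add (i j : ℕ) : IsLinearMap ℝ fun v : ℕ → ℝ => v i + v j :=
  ⟨fun v w => add_add_add_comm (v i) (w i) (v j) (w j), fun c v => (mul_add c (v i) (v j)).symm⟩

theorem convex_setOf_add_pos (i j : ℕ) : Convex ℝ {v : ℕ → ℝ | 0 < v i + v j} :=
  convex_halfSpace_gt (isLinearMap_add i j) 0

theorem convex_setOf_add_neg (i j : ℕ) : Convex ℝ {v : ℕ → ℝ | v i + v j < 0} :=
  convex_halfSpace_lt (isLinearMap_add i j) 0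

theorem convex_chamber : Convex ℝ (chamber P) := by
  intro x hx y hy c d hc hd hcd
  refine ⟨fun i j hij => ?_, fun i j hij => ⟨fun hP => ?_, fun hP => ?_⟩⟩
  · exact convex_setOf_lt i j (hx.1 hij) (hy.1 hij) hc hd hcd
  · exact convex_setOf_add_pos i j ((hx.2 i j hij).1 hP) ((hy.2 i j hij).1 hP) hc hd hcd
  · exact convex_setOf_add_neg i j ((hx.2 i j hij).2 hP) ((hy.2 i j hij).2 hP) hc hd hcd

theorem pos_of_mem_connectedComponentIn {X : Type*} [TopologicalSpace X] {U : Set X} {x y : X}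
    {f : X → ℝ} (hf : ContinuousOn f U) (hne : ∀ z ∈ U, f z ≠ 0)
    (hy : y ∈ connectedComponentIn U x) (hx : 0 < f x) : 0 < f y := by
  have hxU : x ∈ U := by
    by_contra hxU
    rwa [connectedComponentIn_eq_empty hxU] at hy
  have hsub := connectedComponentIn_subset U x
  by_contra hle
  obtain ⟨z, hz, hz0⟩ := isPreconnected_connectedComponentIn.intermediate_value hy
    (mem_connectedComponentIn hxU) (hf.mono hsub) ⟨not_lt.1 hle, hx.le⟩
  exact hne z (hsub hz) hz0

theorem connectedComponentIn_eq_chamber (hx : x ∈ chamber P) :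
    connectedComponentIn regularPoints x = chamber P := by
  have hne {z : ℕ → ℝ} (hz : z ∈ regularPoints) {i j : ℕ} (hij : i < j) :
      z i - z j ≠ 0 ∧ z i + z j ≠ 0 :=
    (mem_regularPoints_iff.1 hz i j hij).imp sub_ne_zero.2 (mt eq_neg_of_add_eq_zero_left)
  refine Set.Subset.antisymm (fun y hy => ?_) ?_
  · refine ⟨fun i j hij => sub_pos.1 ?_, fun i j hij => ⟨fun hP => ?_, fun hP => neg_pos.1 ?_⟩⟩
    · exact pos_of_mem_connectedComponentIn (f := fun z => z i - z j) (by fun_prop)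
        (fun z hz => (hne hz hij).1) hy (sub_pos.2 (hx.1 hij))
    · exact pos_of_mem_connectedComponentIn (f := fun z => z i + z j) (by fun_prop)
        (fun z hz => (hne hz hij).2) hy ((hx.2 i j hij).1 hP)
    · exact pos_of_mem_connectedComponentIn (f := fun z => -(z i + z j)) (by fun_prop)
        (fun z hz => neg_ne_zero.2 (hne hz hij).2) hy (neg_pos.2 ((hx.2 i j hij).2 hP))
  · exact convex_chamber.isPreconnected.subset_connectedComponentIn hx chamber_subset_regularPoints

theorem fundamentalAlcove_eq_chamber : fundamentalAlcove = chamber ∅ := by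
  refine Set.ext fun y => and_congr_right fun hy => ⟨fun h i j hij => ⟨False.elim, fun _ => ?_⟩,
    fun h => (h 0 1 Nat.zero_lt_one).2 id⟩
  linarith [hy.antitone (Nat.zero_le i), hy.antitone (show 1 ≤ j by omega)]

theorem eq_of_chamber_eq (hx : x ∈ chamber P) (h : chamber P = chamber Q)
    (hP : P ⊆ {q | q.1 < q.2}) (hQ : Q ⊆ {q | q.1 < q.2}) : P = Q := by
  ext ⟨i, j⟩
  by_cases hij : i < j
  · exact (mem_iff_pos_of_mem_chamber hx hij).trans (mem_iff_pos_of_mem_chamber (h ▸ hx) hij).symm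
  · exact iff_of_false (fun h => hij (hP h)) fun h => hij (hQ h)

/-! ### Lengths and walls -/

theorem sumHyperplane_injective {k l : ℕ} (hij : i < j) (hkl : k < l)
    (h : {v : ℕ → ℝ | v i = -v j} = {v | v k = -v l}) : (i, j) = (k, l) := by
  let v : ℕ → ℝ := fun n => if n = i then 1 else if n = j then -1 else 2
  have hv : v ∈ {v : ℕ → ℝ | v i = -v j} := by
    simp [v, hij.ne']
  rw [h] at hv
  simp only [Set.mem_ofPred_eq, v] at hv
  rw [Prod.mk.injEq]
  split_ifs at hv <;> first | omega | norm_num at hv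

theorem exists_mem_segment_eq_zero {f : (ℕ → ℝ) → ℝ} (hf : Continuous f) (hx : f x < 0)
    (hy : 0 < f y) : ∃ z ∈ segment ℝ x y, f z = 0 :=
  (convex_segment x y).isPreconnected.intermediate_value (left_mem_segment ℝ x y)
    (right_mem_segment ℝ x y) hf.continuousOn ⟨hx.le, hy.le⟩

theorem not_separates_of_convex {A B C H : Set (ℕ → ℝ)} (hC : Convex ℝ C) (hA : (A ∩ C).Nonempty)
    (hB : (B ∩ C).Nonempty) (hH : Disjoint C H) : ¬ Separates H A B := by
  obtain ⟨x, hxA, hxC⟩ := hA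
  obtain ⟨y, hyB, hyC⟩ := hB
  intro hsep
  obtain ⟨z, hz, hzH⟩ := hsep x hxA y hyB
  exact Set.disjoint_left.1 hH (hC.segment_subset hxC hyC hz) hzH

theorem not_separates_of_strictAnti {A B : Set (ℕ → ℝ)} (hij : i < j)
    (hA : ∃ x ∈ A, StrictAnti x) (hB : ∃ y ∈ B, StrictAnti y) :
    ¬ Separates {v | v i = v j} A B := by
  refine not_separates_of_convex (convex_setOf_lt i j) ?_ ?_ ?_
  · exact hA.imp fun x hx => ⟨hx.1, hx.2 hij⟩
  · exact hB.imp fun y hy => ⟨hy.1, hy.2 hij⟩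
  · exact Set.disjoint_left.2 fun v hv heq => hv.ne' heq

theorem separates_chamber_iff (hij : i < j) (hempty : (chamber ∅).Nonempty)
    (hP : (chamber P).Nonempty) :
    Separates {v | v i = -v j} (chamber ∅) (chamber P) ↔ (i, j) ∈ P := by
  constructor
  · contrapose
    refine fun hmem => not_separates_of_convex (convex_setOf_add_neg i j) ?_ ?_ ?_
    · exact hempty.imp fun x hx => ⟨hx, (hx.2 i j hij).2 id⟩
    · exact hP.imp fun y hy => ⟨hy, (hy.2 i j hij).2 hmem⟩
    · exact Set.disjoint_left.2 fun v hv heq => hv.ne (add_eq_zero_iff_eq_neg.2 heq)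
  · intro hmem x hx y hy
    obtain ⟨z, hz, hz0⟩ := exists_mem_segment_eq_zero (f := fun v => v i + v j) (by fun_prop)
      ((hx.2 i j hij).2 id) ((hy.2 i j hij).1 hmem)
    exact ⟨z, hz, eq_neg_of_add_eq_zero_left hz0⟩

theorem alcoveLength_chamber (hempty : (chamber ∅).Nonempty) (hP : (chamber P).Nonempty)
    (hlt : P ⊆ {q | q.1 < q.2}) : alcoveLength (chamber P) = P.ncard := by
  have hseparating : {H | H ∈ hyperplanes ∧ Separates H fundamentalAlcove (chamber P)} =
      (fun q : ℕ × ℕ => {v : ℕ → ℝ | v q.1 = -v q.2}) '' P := by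
    rw [fundamentalAlcove_eq_chamber]
    ext H
    constructor
    · rintro ⟨⟨i, j, hij, rfl | rfl⟩, hsep⟩
      · exact absurd hsep (not_separates_of_strictAnti hij (hempty.imp fun x hx => ⟨hx, hx.1⟩)
          (hP.imp fun y hy => ⟨hy, hy.1⟩))
      · exact ⟨(i, j), (separates_chamber_iff hij hempty hP).1 hsep, rfl⟩
    · rintro ⟨⟨i, j⟩, hq, rfl⟩
      exact ⟨⟨i, j, hlt hq, Or.inr rfl⟩, (separates_chamber_iff (hlt hq) hempty hP).2 hq⟩
  rw [alcoveLength, hseparating]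
  exact Set.InjOn.ncard_image fun q hq q' hq' h => sumHyperplane_injective (hlt hq) (hlt hq') h

theorem mem_closure_chamber_iff (hne : (chamber P).Nonempty) : y ∈ closure (chamber P) ↔
    Antitone y ∧ ∀ i j, i < j → ((i, j) ∈ P → 0 ≤ y i + y j) ∧ ((i, j) ∉ P → y i + y j ≤ 0) := by
  constructor
  · intro hy
    have mem_of_isClosed {C : Set (ℕ → ℝ)} (hC : IsClosed C) (hsub : chamber P ⊆ C) : y ∈ C :=
      closure_minimal hsub hC hy
    refine ⟨fun i j hij => ?_, fun i j hij => ⟨fun hP => ?_, fun hP => ?_⟩⟩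
    · exact mem_of_isClosed (isClosed_le (continuous_apply j) (continuous_apply i))
        fun v hv => hv.1.antitone hij
    · exact mem_of_isClosed (C := {v | 0 ≤ v i + v j})
        (isClosed_le continuous_const (by fun_prop)) fun v hv => ((hv.2 i j hij).1 hP).le
    · exact mem_of_isClosed (C := {v | v i + v j ≤ 0})
        (isClosed_le (by fun_prop) continuous_const) fun v hv => ((hv.2 i j hij).2 hP).le
  · rintro ⟨hanti, hy⟩
    obtain ⟨x, hx⟩ := hne
    suffices hsub : openSegment ℝ x y ⊆ chamber P by
      exact closure_mono hsub (closure_openSegment (𝕜 := ℝ) x y ▸ right_mem_segment ℝ x y)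
    rintro _ ⟨c, d, hc, hd, -, rfl⟩
    refine ⟨fun i j hij => ?_, fun i j hij => ⟨fun hP => ?_, fun hP => ?_⟩⟩ <;>
      simp only [Pi.add_apply, Pi.smul_apply, smul_eq_mul]
    · nlinarith [hx.1 hij, hanti hij.le]
    · nlinarith [(hx.2 i j hij).1 hP, (hy i j hij).1 hP]
    · nlinarith [(hx.2 i j hij).2 hP, (hy i j hij).2 hP]

theorem ShareWall.symmDiff_subsingleton (hP : P ⊆ {q | q.1 < q.2}) (hQ : Q ⊆ {q | q.1 < q.2})
    (hneP : (chamber P).Nonempty) (hneQ : (chamber Q).Nonempty)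
    (h : ShareWall (chamber P) (chamber Q)) : (symmDiff P Q).Subsingleton := by
  obtain ⟨H, -, p, ⟨hpP, hpQ⟩, -, honly⟩ := h
  rw [mem_closure_chamber_iff hneP] at hpP
  rw [mem_closure_chamber_iff hneQ] at hpQ
  have lt_of_mem {k l : ℕ} (hkl : (k, l) ∈ symmDiff P Q) : k < l :=
    hkl.elim (fun h => hP h.1) fun h => hQ h.1
  have eq_wall {k l : ℕ} (hkl : (k, l) ∈ symmDiff P Q) : {v : ℕ → ℝ | v k = -v l} = H := by
    have hlt := lt_of_mem hkl
    by_contra hne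
    refine honly ⟨_, ⟨⟨k, l, hlt, Or.inr rfl⟩, hne⟩, eq_neg_of_add_eq_zero_left ?_⟩
    rcases hkl with ⟨hmem, hnotMem⟩ | ⟨hmem, hnotMem⟩
    · exact ((hpQ.2 k l hlt).2 hnotMem).antisymm ((hpP.2 k l hlt).1 hmem)
    · exact ((hpP.2 k l hlt).2 hnotMem).antisymm ((hpQ.2 k l hlt).1 hmem)
  intro q hq q' hq'
  exact sumHyperplane_injective (lt_of_mem hq) (lt_of_mem hq')
    ((eq_wall hq).trans (eq_wall hq').symm)

theorem exists_eq_insert_of_symmDiff_subsingleton {X : Type*} {s t : Set X} (hs : s.Finite)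
    (h : (symmDiff s t).Subsingleton) (hcard : t.ncard = s.ncard + 1) :
    ∃ q ∉ s, t = insert q s := by
  obtain ⟨q, hqt, hqs⟩ := Set.exists_mem_notMem_of_ncard_lt_ncard (by omega : s.ncard < t.ncard) hs
  refine ⟨q, hqs, Set.ext fun x => ?_⟩
  have hx : x ∈ symmDiff s t → x = q := fun hx => h hx (Or.inr ⟨hqt, hqs⟩)
  grind

theorem shareWall_insert (hij : i < j) (hnotMem : (i, j) ∉ P) (hP : (chamber P).Nonempty)
    (hQ : (chamber (insert (i, j) P)).Nonempty) :
    ShareWall (chamber P) (chamber (insert (i, j) P)) := by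
  obtain ⟨⟨x, hx⟩, ⟨y, hy⟩⟩ := And.intro hP hQ
  obtain ⟨z, hz, hz0⟩ := exists_mem_segment_eq_zero (f := fun v => v i + v j) (by fun_prop)
    ((hx.2 i j hij).2 hnotMem) ((hy.2 i j hij).1 (Set.mem_insert _ _))
  have hanti : StrictAnti z := fun k l hkl =>
    (convex_setOf_lt k l).segment_subset (hx.1 hkl) (hy.1 hkl) hz
  have hpos {k l : ℕ} (hkl : k < l) (hmem : (k, l) ∈ P) : 0 < z k + z l :=
    (convex_setOf_add_pos k l).segment_subset ((hx.2 k l hkl).1 hmem)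
      ((hy.2 k l hkl).1 (Set.mem_insert_of_mem _ hmem)) hz
  have hneg {k l : ℕ} (hkl : k < l) (hmem : (k, l) ∉ insert (i, j) P) : z k + z l < 0 :=
    (convex_setOf_add_neg k l).segment_subset
      ((hx.2 k l hkl).2 fun h => hmem (Set.mem_insert_of_mem _ h)) ((hy.2 k l hkl).2 hmem) hz
  refine ⟨_, ⟨i, j, hij, Or.inr rfl⟩, z, ⟨?_, ?_⟩, eq_neg_of_add_eq_zero_left hz0, ?_⟩
  · refine (mem_closure_chamber_iff hP).2
      ⟨hanti.antitone, fun k l hkl => ⟨fun hmem => (hpos hkl hmem).le, fun hmem => ?_⟩⟩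
    by_cases heq : (k, l) = (i, j)
    · obtain ⟨rfl, rfl⟩ := Prod.mk.inj heq
      exact hz0.le
    · exact (hneg hkl (by simp [heq, hmem])).le
  · refine (mem_closure_chamber_iff hQ).2
      ⟨hanti.antitone, fun k l hkl => ⟨fun hmem => ?_, fun hmem => (hneg hkl hmem).le⟩⟩
    rcases hmem with heq | hmem
    · obtain ⟨rfl, rfl⟩ := Prod.mk.inj heq
      exact hz0.ge
    · exact (hpos hkl hmem).le
  · rintro ⟨H, ⟨⟨k, l, hkl, rfl | rfl⟩, hne⟩, hzH⟩
    · exact (hanti hkl).ne' hzH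
    · have hzero : z k + z l = 0 := by rw [hzH, neg_add_cancel]
      by_cases hmem : (k, l) ∈ P
      · exact (hpos hkl hmem).ne' hzero
      · refine (hneg hkl ?_).ne hzero
        rintro (heq | hmem')
        · exact hne (by rw [(Prod.mk.inj heq).1, (Prod.mk.inj heq).2]; rfl)
        · exact hmem hmem'

/-- An integer sequence as a point of the real space containing the alcoves. -/
def toReal (s : ℕ → ℤ) : ℕ → ℝ := fun i => s i

variable {a b : Set ℕ+} {s t : ℕ → ℤ}

theorem posPairs_subset : posPairs s ⊆ {q | q.1 < q.2} := fun _ hq => hq.1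

theorem IsSignedSeq.toReal_mem_chamber (hs : IsSignedSeq a s) :
    toReal s ∈ chamber (posPairs s) := by
  have hanti : StrictAnti (toReal s) := fun i j hij => Int.cast_lt.2 (hs.strictAnti hij)
  refine ⟨hanti, fun i j hij => ⟨fun hP => ?_, fun hP => ?_⟩⟩ <;> simp only [toReal]
  · have hpos : 0 < s i + s j := hP.2
    exact_mod_cast hpos
  · have hle : s i + s j ≤ 0 := not_lt.1 fun hpos => hP ⟨hij, hpos⟩
    exact_mod_cast lt_of_le_of_ne hle (hs.add_ne_zero i j)

theorem posPairs_neg_succ : posPairs (fun i => -((i : ℤ) + 1)) = ∅ := by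
  refine Set.eq_empty_of_forall_notMem fun q hq => ?_
  have hpos : 0 < -((q.1 : ℤ) + 1) + -((q.2 : ℤ) + 1) := hq.2
  omega

theorem toReal_neg_succ_mem_chamber : toReal (fun i => -((i : ℤ) + 1)) ∈ chamber ∅ :=
  posPairs_neg_succ ▸ isSignedSeq_empty.toReal_mem_chamber

theorem IsSignedSeq.alcoveLength_chamber (hs : IsSignedSeq a s) :
    alcoveLength (chamber (posPairs s)) = (posPairs s).ncard :=
  BrauerBlock.alcoveLength_chamber ⟨_, toReal_neg_succ_mem_chamber⟩ ⟨_, hs.toReal_mem_chamber⟩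
    posPairs_subset

theorem adj_chamber_iff (hs : IsSignedSeq a s) (ht : IsSignedSeq b t) (ha : a ∈ evenSubsets)
    (hb : b ∈ evenSubsets) :
    (ShareWall (chamber (posPairs s)) (chamber (posPairs t)) ∧
      alcoveLength (chamber (posPairs t)) = alcoveLength (chamber (posPairs s)) + 1) ↔
      ∃ l, LabelledEdge l a b := by
  have hneS : (chamber (posPairs s)).Nonempty := ⟨_, hs.toReal_mem_chamber⟩
  have hneT : (chamber (posPairs t)).Nonempty := ⟨_, ht.toReal_mem_chamber⟩
  have hfin := posPairs_finite hs.strictAnti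
  rw [hs.alcoveLength_chamber, ht.alcoveLength_chamber]
  constructor
  · rintro ⟨hwall, hcard⟩
    obtain ⟨⟨i, j⟩, hq, hinsert⟩ := exists_eq_insert_of_symmDiff_subsingleton hfin
      (hwall.symmDiff_subsingleton posPairs_subset posPairs_subset hneS hneT) hcard
    exact labelledEdge_of_posPairs_insert hs ht ha hb hq hinsert
  · intro hedge
    obtain ⟨i, j, hij, -, hnotMem, hinsert⟩ := hs.exists_reflection ht hedge
    rw [hinsert, Set.ncard_insert_of_notMem hnotMem hfin]
    exact ⟨shareWall_insert hij hnotMem hneS (hinsert ▸ hneT), rfl⟩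

end

section

/-! ### The reflection group -/

variable {a : Set ℕ+} {s : ℕ → ℤ} {i j : ℕ} {v x : ℕ → ℝ} {w : Equiv.Perm (ℕ → ℝ)}

theorem reflMinus_apply (i j : ℕ) (v : ℕ → ℝ) (k : ℕ) :
    reflMinus i j v k = if k = i ∨ k = j then -v (Equiv.swap i j k) else v k := rfl

theorem reflMinus_toReal : reflMinus i j (toReal s) = toReal (reflect i j s) := by
  funext k
  simp only [reflMinus_apply, toReal, reflect]
  split_ifs <;> push_cast <;> rfl

theorem abs_reflMinus_apply (i j : ℕ) (v : ℕ → ℝ) (k : ℕ) :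
    |reflMinus i j v k| = |v (Equiv.swap i j k)| := by
  rw [reflMinus_apply]
  split_ifs with h
  · rw [abs_neg]
  · rw [not_or] at h
    rw [Equiv.swap_apply_of_ne_of_ne h.1 h.2]

theorem groupD_induction {Q : (ℕ → ℝ) → Prop}
    (hplus : ∀ i j v, i < j → Q v → Q (reflPlus i j v))
    (hminus : ∀ i j v, i < j → Q v → Q (reflMinus i j v)) (hw : w ∈ groupD) (v : ℕ → ℝ) :
    Q (w v) ↔ Q v := by
  induction hw using Subgroup.closure_induction generalizing v with
  | mem w hw =>
    obtain ⟨i, j, hij, rfl | rfl⟩ := hw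
    · exact ⟨fun h => (reflPlus i j).left_inv v ▸ hplus i j _ hij h, hplus i j v hij⟩
    · exact ⟨fun h => (reflMinus i j).left_inv v ▸ hminus i j _ hij h, hminus i j v hij⟩
  | one => exact Iff.rfl
  | mul w w' _ _ ih ih' => exact (ih (w' v)).trans (ih' v)
  | inv w _ ih =>
    have hcancel := ih (w.symm v)
    rw [Equiv.apply_symm_apply] at hcancel
    exact hcancel.symm

theorem groupD_apply_mem_regularPoints_iff (hw : w ∈ groupD) :
    w v ∈ regularPoints ↔ v ∈ regularPoints := by
  simp only [mem_regularPoints_iff_abs]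
  refine groupD_induction (Q := fun v => Function.Injective fun i => |v i|) ?_ ?_ hw v
  · exact fun i j v _ hv => hv.comp (Equiv.swap i j).injective
  · intro i j v _ hv
    simp only [abs_reflMinus_apply]
    exact hv.comp (Equiv.swap i j).injective

theorem continuous_reflPlus (i j : ℕ) : Continuous (reflPlus i j) :=
  continuous_pi fun k => continuous_apply (Equiv.swap i j k)

theorem continuous_reflMinus (i j : ℕ) : Continuous (reflMinus i j) := by
  refine continuous_pi fun k => ?_
  simp only [reflMinus_apply]
  split_ifs <;> fun_prop

theorem groupD_continuous (hw : w ∈ groupD) : Continuous w ∧ Continuous w.symm := by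
  induction hw using Subgroup.closure_induction with
  | mem w hw =>
    obtain ⟨i, j, -, rfl | rfl⟩ := hw
    · exact ⟨continuous_reflPlus i j, continuous_reflPlus i j⟩
    · exact ⟨continuous_reflMinus i j, continuous_reflMinus i j⟩
  | one => exact ⟨continuous_id, continuous_id⟩
  | mul w w' _ _ ih ih' => exact ⟨ih.1.comp ih'.1, ih'.2.comp ih.2⟩
  | inv w _ ih => exact ih.symm

theorem groupD_image_connectedComponentIn (hw : w ∈ groupD) (hx : x ∈ regularPoints) :
    w '' connectedComponentIn regularPoints x = connectedComponentIn regularPoints (w x) := by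
  let homeo : (ℕ → ℝ) ≃ₜ (ℕ → ℝ) := ⟨w, (groupD_continuous hw).1, (groupD_continuous hw).2⟩
  have himage : homeo '' regularPoints = regularPoints := by
    rw [← Set.eq_preimage_iff_image_eq homeo.bijective]
    exact Set.ext fun v => (groupD_apply_mem_regularPoints_iff hw).symm
  have hcomponent := homeo.image_connectedComponentIn hx
  rwa [himage] at hcomponent

theorem groupD_image_fundamentalAlcove (hw : w ∈ groupD) : w '' fundamentalAlcove =
    connectedComponentIn regularPoints (w (toReal fun i => -((i : ℤ) + 1))) := by
  rw [fundamentalAlcove_eq_chamber, ← connectedComponentIn_eq_chamber toReal_neg_succ_mem_chamber]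
  exact groupD_image_connectedComponentIn hw
    (chamber_subset_regularPoints toReal_neg_succ_mem_chamber)

theorem symmDiff_pair_mem_evenSubsets {m n : ℕ+} (ha : a ∈ evenSubsets) (hmn : m ≠ n) :
    symmDiff a {m, n} ∈ evenSubsets :=
  ⟨ha.1.symmDiff (Set.toFinite _), (even_ncard_symmDiff_pair ha.1 hmn).2 ha.2⟩

theorem IsSignedEnum.exists_reflect (hs : IsSignedEnum a s) (ha : a ∈ evenSubsets) (hij : i ≠ j) :
    ∃ b ∈ evenSubsets, IsSignedEnum b (reflect i j s) := by
  let magnitude (k : ℕ) : ℕ+ := ⟨(s k).natAbs, Int.natAbs_pos.2 (hs.ne_zero k)⟩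
  have hne : magnitude i ≠ magnitude j := fun heq =>
    hij (hs.natAbs_injective (congrArg PNat.val heq))
  exact ⟨_, symmDiff_pair_mem_evenSubsets ha hne, hs.symmDiff_reflect hij rfl rfl⟩

theorem exists_isSignedEnum_groupD_apply (hw : w ∈ groupD) (hs : IsSignedEnum a s)
    (ha : a ∈ evenSubsets) :
    ∃ b ∈ evenSubsets, ∃ t, IsSignedEnum b t ∧ w (toReal s) = toReal t := by
  refine (groupD_induction (Q := fun v => ∃ b ∈ evenSubsets, ∃ t, IsSignedEnum b t ∧ v = toReal t)
    ?_ ?_ hw (toReal s)).2 ⟨a, ha, s, hs, rfl⟩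
  · rintro i j _ - ⟨b, hb, t, ht, rfl⟩
    exact ⟨b, hb, _, ht.comp_equiv (Equiv.swap i j), rfl⟩
  · rintro i j _ hij ⟨b, hb, t, ht, rfl⟩
    obtain ⟨c, hc, hreflect⟩ := ht.exists_reflect hb hij.ne
    exact ⟨c, hc, _, hreflect, reflMinus_toReal⟩

/-! ### The block of the empty diagram for `δ = 2` -/

theorem dblSet_two_bot : dblSet 2 ⊥ = Set.range fun n : ℕ+ => -(2 * (n : ℤ)) := by
  have hrow (i : ℕ) : (⊥ : YoungDiagram).rowLen i = 0 := by
    by_contra h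
    exact YoungDiagram.notMem_bot (i, 0)
      (YoungDiagram.mem_iff_lt_rowLen.2 (Nat.pos_of_ne_zero h))
  rw [dblSet_eq_range, ← Equiv.pnatEquivNat.symm.surjective.range_comp]
  refine congrArg Set.range (funext fun i => ?_)
  simp only [bead, hrow, Function.comp_apply, Equiv.pnatEquivNat_symm_apply, Nat.succPNat_coe]
  push_cast
  ring

theorem posMags_two_bot : posMags (dblSet 2 ⊥) = ∅ := by
  refine Set.eq_empty_of_forall_notMem fun k hk => ?_
  rw [dblSet_two_bot] at hk
  obtain ⟨n, hn⟩ := hk.1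
  have := n.pos
  simp only at hn
  omega

theorem mem_singleMags_two_bot {k : ℕ} :
    k ∈ singleMags (dblSet 2 ⊥) ↔ ∃ n : ℕ+, 2 * (n : ℕ) = k := by
  simp only [dblSet_two_bot, singleMags, Set.mem_range, Set.mem_ofPred_eq]
  constructor
  · rintro ⟨⟨n, hn⟩ | ⟨n, hn⟩, -⟩
    · have := n.pos
      omega
    · exact ⟨n, by omega⟩
  · rintro ⟨n, rfl⟩
    refine ⟨Or.inr ⟨n, by push_cast; rfl⟩, fun ⟨m, hm⟩ => ?_⟩
    have := m.pos
    omega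

theorem place_singleMags_two_bot (n : ℕ+) : place (singleMags (dblSet 2 ⊥)) n = 2 * (n : ℕ) := by
  have hM := singleMags_infinite 2 ⊥
  have hmono : StrictMono fun n : ℕ+ => 2 * (n : ℕ) := fun n m h =>
    Nat.mul_lt_mul_of_pos_left h two_pos
  refine congrFun (((place_strictMono hM).range_inj hmono).1 ?_) n
  rw [range_place hM]
  exact Set.ext fun k => mem_singleMags_two_bot

theorem untoggled_two_bot : untoggled 2 ⊥ = ∅ := by
  refine Set.eq_empty_of_forall_notMem fun n hn => ?_
  rw [mem_untoggled_iff, upMags_of_even (by simp [posMags_two_bot]), posMags_two_bot] at hn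
  exact hn

/-- The sequence `e_2(μ)`, whose entries are integers. -/
def intSeq (μ : YoungDiagram) (i : ℕ) : ℤ := bead μ i - 1

theorem toReal_intSeq (μ : YoungDiagram) : toReal (intSeq μ) = eMap 2 μ := by
  funext i
  simp only [toReal, intSeq, bead, eMap]
  push_cast
  ring

variable {μ : YoungDiagram}

theorem untoggled_mem_evenSubsets (h : μ ∈ block 2 ⊥) : untoggled 2 μ ∈ evenSubsets :=
  ⟨untoggled_finite 2 μ, (mem_block_iff.1 h).2.1 (by simp [untoggled_two_bot])⟩

theorem oMap_eq_untoggled (h : μ ∈ block 2 ⊥) : oMap 2 μ = untoggled 2 μ :=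
  if_neg (Nat.not_odd_iff_even.2 (untoggled_mem_evenSubsets h).2)

theorem mem_range_intSeq {z : ℤ} : z ∈ Set.range (intSeq μ) ↔ 2 * z ∈ dblSet 2 μ := by
  rw [dblSet_eq_range]
  refine exists_congr fun i => ?_
  simp only [intSeq]
  omega

theorem mem_untoggled_iff_mem_range_intSeq (h : μ ∈ block 2 ⊥) (n : ℕ+) :
    n ∈ untoggled 2 μ ↔ (n : ℤ) ∈ Set.range (intSeq μ) := by
  have hcore := (mem_block_iff.1 h).1
  have hpos : 0 < 2 * (n : ℕ) := by simp
  have hsingle : 2 * (n : ℕ) ∈ singleMags (dblSet 2 μ) :=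
    hcore.singleMags_eq ▸ mem_singleMags_two_bot.2 ⟨n, rfl⟩
  have hcast : 2 * (n : ℤ) = (2 * (n : ℕ) : ℕ) := by push_cast; rfl
  rw [mem_untoggled_iff, ← hcore.singleMags_eq, place_singleMags_two_bot, mem_upMags_of_pos hpos,
    mem_range_intSeq, hcast]
  exact ⟨fun hup => hup.1, fun hmem => ⟨hmem, fun hneg => hpos.ne' (hsingle.2 hmem hneg)⟩⟩

theorem isSignedSeq_intSeq (h : μ ∈ block 2 ⊥) : IsSignedSeq (untoggled 2 μ) (intSeq μ) := by
  have hanti : StrictAnti (intSeq μ) := fun i j hij =>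
    Int.sub_lt_sub_right (bead_strictAnti μ hij) 1
  refine ⟨⟨hanti.injective, fun z => ?_, mem_untoggled_iff_mem_range_intSeq h⟩, hanti⟩
  have hcore := (mem_block_iff.1 h).1 (2 * z)
  have hbot (w : ℤ) : 2 * w ∈ dblSet 2 ⊥ ↔ w < 0 := by
    rw [dblSet_two_bot]
    exact ⟨fun ⟨n, hn⟩ => by have := n.pos; simp only at hn; omega,
      fun hw => ⟨⟨(-w).toNat, by omega⟩, by simp only [PNat.mk_coe]; omega⟩⟩
  rw [← mul_neg, hbot, hbot] at hcore
  rw [mem_range_intSeq, mem_range_intSeq]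
  constructor
  · intro hneg
    exact ⟨fun hmem => by have := hcore.1.2 ⟨hmem, hneg⟩; omega, by
      rintro rfl
      have := hcore.2.2 (Or.inr hneg)
      omega⟩
  · rintro ⟨hmem, hz⟩
    exact (hcore.2.1 (by omega)).resolve_left hmem

theorem exists_groupD_apply (h : μ ∈ block 2 ⊥) :
    ∃ w ∈ groupD, w (toReal fun i => -((i : ℤ) + 1)) = toReal (intSeq μ) := by
  induction μ using skew_induction 2 with
  | base μ hμ =>
    have hempty : untoggled 2 μ = ∅ := eq_of_symmDiff_subset_singleton (untoggled_finite 2 μ)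
      (iff_of_true (untoggled_mem_evenSubsets h).2 (by simp))
      (by rwa [← Set.bot_eq_empty, symmDiff_bot])
    have hs := isSignedSeq_intSeq h
    rw [hempty] at hs
    exact ⟨1, groupD.one_mem, congrArg toReal (isSignedSeq_empty.unique hs)⟩
  | step μ ν hskew ih =>
    have hμ : μ ∈ block 2 ⊥ := .trans _ _ _ h (.symm _ _ hskew.eqvGen)
    obtain ⟨w, hw, hweq⟩ := ih hμ
    obtain ⟨i, j, hij, heq, -, -⟩ :=
      (isSignedSeq_intSeq hμ).exists_reflection (isSignedSeq_intSeq h)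
        (isMinBalancedSkew_iff_labelledEdge.1 hskew).2
    refine ⟨reflMinus i j * w,
      groupD.mul_mem (Subgroup.subset_closure ⟨i, j, hij, Or.inr rfl⟩) hw, ?_⟩
    rw [Equiv.Perm.mul_apply, hweq, reflMinus_toReal, heq]

theorem chamber_intSeq_mem_dominantAlcoves (h : μ ∈ block 2 ⊥) :
    chamber (posPairs (intSeq μ)) ∈ dominantAlcoves := by
  have hmem := (isSignedSeq_intSeq h).toReal_mem_chamber
  have hcomponent := connectedComponentIn_eq_chamber hmem
  obtain ⟨w, hw, heq⟩ := exists_groupD_apply h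
  refine ⟨⟨_, chamber_subset_regularPoints hmem, hcomponent.symm⟩, ⟨w, hw, ?_⟩, fun y hy => hy.1⟩
  rw [groupD_image_fundamentalAlcove hw, heq, hcomponent]

theorem exists_chamber_intSeq_eq {A : Set (ℕ → ℝ)} (hA : A ∈ dominantAlcoves) :
    ∃ μ ∈ block 2 ⊥, chamber (posPairs (intSeq μ)) = A := by
  obtain ⟨-, ⟨w, hw, rfl⟩, hdominant⟩ := hA
  rw [groupD_image_fundamentalAlcove hw] at hdominant ⊢
  obtain ⟨a, ha, s, hs, heq⟩ := exists_isSignedEnum_groupD_apply hw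
    isSignedSeq_empty.toIsSignedEnum ⟨Set.finite_empty, by simp⟩
  have hregular : w (toReal fun i => -((i : ℤ) + 1)) ∈ regularPoints :=
    (groupD_apply_mem_regularPoints_iff hw).2
      (chamber_subset_regularPoints toReal_neg_succ_mem_chamber)
  have hanti := hdominant (mem_connectedComponentIn hregular)
  rw [heq] at hanti ⊢
  have hs : IsSignedSeq a s := ⟨hs, fun i j hij => Int.cast_lt.1 (hanti hij)⟩
  obtain ⟨μ, hμ, rfl⟩ := (oMap_bijOn 2 ⊥).surjOn ha
  rw [oMap_eq_untoggled hμ] at hs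
  refine ⟨μ, hμ, ?_⟩
  rw [(isSignedSeq_intSeq hμ).unique hs, connectedComponentIn_eq_chamber hs.toReal_mem_chamber]

theorem exists_iso_graphAlc : ∃ Ξ : DigraphIso (blockGraph 2 ⊥) graphAlc,
    ∀ μ, eMap 2 μ ∈ (Ξ μ : Set (ℕ → ℝ)) := by
  have hseq (μ : block 2 ⊥) := isSignedSeq_intSeq μ.2
  have heven (μ : block 2 ⊥) := untoggled_mem_evenSubsets μ.2
  let alcove (μ : block 2 ⊥) : dominantAlcoves := ⟨_, chamber_intSeq_mem_dominantAlcoves μ.2⟩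
  have hbij : Function.Bijective alcove := by
    refine ⟨fun μ ν h => Subtype.ext ?_, fun A => ?_⟩
    · have hpairs := eq_of_chamber_eq (hseq μ).toReal_mem_chamber (congrArg Subtype.val h)
        posPairs_subset posPairs_subset
      exact eq_of_sameCore_of_untoggled (sameCore_of_mem_block μ.2 ν.2)
        (eq_of_posPairs_eq (hseq μ) (hseq ν) (heven μ) (heven ν) hpairs)
    · obtain ⟨μ, hμ, heq⟩ := exists_chamber_intSeq_eq A.2
      exact ⟨⟨μ, hμ⟩, Subtype.ext heq⟩
  refine ⟨⟨Equiv.ofBijective alcove hbij, fun {μ ν} => ?_⟩, fun μ => ?_⟩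
  · rw [adj_blockGraph_iff]
    exact adj_chamber_iff (hseq μ) (hseq ν) (heven μ) (heven ν)
  · rw [← toReal_intSeq]
    exact (hseq μ).toReal_mem_chamber

end

end BrauerBlock

theorem mainTheorem2 :
    ∃ (T : BrauerBlock.DigraphIso BrauerBlock.graphOdd BrauerBlock.graphEven)
      (Θ : BrauerBlock.DigraphIso BrauerBlock.graphEven BrauerBlock.graphAlc),
      -- the toggle map is an isomorphism from `G_odd` to `G_even`
      (∀ a, (T a : Set ℕ+) = BrauerBlock.toggle a) ∧
      -- `G_even ≅ G_alc`: the alcove of `o_2(μ)`, `μ ∈ [∅]_2`, is the one containing `e_2(μ)`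
      (∀ μ ∈ BrauerBlock.block 2 ⊥, ∀ a : BrauerBlock.evenSubsets,
        (a : Set ℕ+) = BrauerBlock.oMap 2 μ →
          BrauerBlock.eMap 2 μ ∈ (Θ a : Set (ℕ → ℝ))) ∧
      (∀ (δ : ℤ) (lam : YoungDiagram),
        -- `o_δ` restricts to a bijection from the block onto the even subsets
        Set.BijOn (BrauerBlock.oMap δ) (BrauerBlock.block δ lam) BrauerBlock.evenSubsets ∧
        -- this bijection is an isomorphism `G_δ(λ) ≅ G_even`
        (∃ Φ : BrauerBlock.DigraphIso (BrauerBlock.blockGraph δ lam) BrauerBlock.graphEven,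
          (∀ ν : BrauerBlock.block δ lam, (Φ ν : Set ℕ+) = BrauerBlock.oMap δ ν) ∧
          -- no toggling is needed on the block of `λ` in the even case
          (Even (BrauerBlock.untoggled δ lam).ncard →
            ∀ ν : BrauerBlock.block δ lam, (Φ ν : Set ℕ+) = BrauerBlock.untoggled δ ν) ∧
          -- in the odd case it factors through `G_odd` and the toggle map
          (Odd (BrauerBlock.untoggled δ lam).ncard →
            ∃ Φ' : BrauerBlock.DigraphIso (BrauerBlock.blockGraph δ lam) BrauerBlock.graphOdd,
              (∀ ν : BrauerBlock.block δ lam, (Φ' ν : Set ℕ+) = BrauerBlock.untoggled δ ν) ∧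
              ∀ ν, Φ ν = T (Φ' ν))) ∧
        -- via `[∅]_2` the map `o_δ` passes to an isomorphism `G_δ(λ) ≅ G_alc`
        (∃ Ψ : BrauerBlock.DigraphIso (BrauerBlock.blockGraph δ lam) BrauerBlock.graphAlc,
          ∀ ν : BrauerBlock.block δ lam, ∃ μ ∈ BrauerBlock.block 2 ⊥,
            BrauerBlock.oMap 2 μ = BrauerBlock.oMap δ ν ∧
              BrauerBlock.eMap 2 μ ∈ (Ψ ν : Set (ℕ → ℝ)))) ∧
      -- all block graphs are isomorphic
      (∀ (δ δ' : ℤ) (lam lam' : YoungDiagram),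
        Nonempty (BrauerBlock.DigraphIso (BrauerBlock.blockGraph δ lam)
          (BrauerBlock.blockGraph δ' lam'))) := by
  obtain ⟨Φ₂, hΦ₂, -⟩ := BrauerBlock.exists_iso_oMap 2 ⊥
  obtain ⟨Ξ, hΞ⟩ := BrauerBlock.exists_iso_graphAlc
  refine ⟨BrauerBlock.toggleIso, Φ₂.symm.trans Ξ, fun a => rfl, fun μ hμ a ha => ?_,
    fun δ lam => ⟨BrauerBlock.oMap_bijOn δ lam, BrauerBlock.exists_iso_oMap δ lam, ?_⟩,
    fun δ δ' lam lam' => ?_⟩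
  · obtain rfl : Φ₂ ⟨μ, hμ⟩ = a := Subtype.ext ((hΦ₂ ⟨μ, hμ⟩).trans ha.symm)
    rw [RelIso.trans_apply, RelIso.symm_apply_apply]
    exact hΞ ⟨μ, hμ⟩
  · obtain ⟨Φ, hΦ, -⟩ := BrauerBlock.exists_iso_oMap δ lam
    refine ⟨Φ.trans (Φ₂.symm.trans Ξ), fun ν =>
      ⟨Φ₂.symm (Φ ν), (Φ₂.symm (Φ ν)).2, ?_, hΞ (Φ₂.symm (Φ ν))⟩⟩
    rw [← hΦ₂, RelIso.apply_symm_apply, hΦ]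
  · obtain ⟨Φ, -⟩ := BrauerBlock.exists_iso_oMap δ lam
    obtain ⟨Φ', -⟩ := BrauerBlock.exists_iso_oMap δ' lam'
    exact ⟨Φ.trans Φ'.symm⟩
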